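/- Let $d\ge 1$, $\boldsymbol b,\boldsymbol x_0\in\mathbb R^d$, $D_o,D_f\ge 0$ with $D_o+D_f>0$, and $\alpha\in(0,1)$. Consider the fractional Fokker--Planck equation $$\partial_t p=-\boldsymbol b\cdot\nabla p+D_o\Delta p-D_f(-\Delta)^\alpha p\quad\text{on }\mathbb R^d\times(0,\infty),\qquad p(\cdot,0)=\delta_{\boldsymbol x_0},$$ where $(-\Delta)^\alpha$ is the Fourier multiplier with symbol $|\boldsymbol k|^{2\alpha}$. A fundamental solution is a function $p$ such that $p(\cdot,t)$ is a continuous probability density for every $t>0$ and such that, for every complex-valued Schwartz function $\varphi$ on $\mathbb R^d$, $$\frac{d}{dt}\int p(\boldsymbol x,t)\varphi(\boldsymbol x)\,d\boldsymbol x=\int p(\boldsymbol x,t)\bigl(\boldsymbol b\cdot\nabla\varphi+D_o\Delta\varphi-D_f(-\Delta)^\alpha\varphi\bigr)(\boldsymbol x)\,d\boldsymbol x\quad(t>0),\qquad \lim_{t\to0^+}\int p(\boldsymbol x,t)\varphi(\boldsymbol x)\,d\boldsymbol x=\varphi(\boldsymbol x_0).$$ Then a fundamental solution exists, and every fundamental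 solution $p$ is given, for all $\boldsymbol x\in\mathbb R^d$ and $t>0$, by the following formulas, where $y=|\boldsymbol x-\boldsymbol x_0-\boldsymbol b t|$ and all the integrals converge absolutely. (i) If $y\ne 0$, then $$p(\boldsymbol x,t)=\frac1{y^{(d-2)/2}}\int_0^\infty\Bigl(\frac r{2\pi}\Bigr)^{d/2}J_{(d-2)/2}(yr)\exp\bigl(-(D_or^2+D_fr^{2\alpha})t\bigr)\,dr,$$ where $J_\nu(z)=\sum_{m\ge0}\frac{(-1)^m}{m!\,\Gamma(m+\nu+1)}(z/2)^{2m+\nu}$ is the Bessel function of the first kind. (ii) If $d=1$, then $$p(x,t)=\frac1\pi\int_0^\infty\cos(yr)\exp\bigl(-(D_or^2+D_fr^{2\alpha})t\bigr)\,dr.$$ (iii) If $y=0$, then $$p(\boldsymbol x,t)=\frac{S_{d-1}}{2\pi}\int_0^\infty\Bigl(\frac r{2\pi}\Bigr)^{d-1}\exp\bigl(-(D_or^2+D_fr^{2\alpha})t\bigr)\,dr,\qquad S_{d-1}=\frac{2\pi^{d/2}}{\Gamma(d/2)}.$$ -/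

import Mathlib

open MeasureTheory Filter Topology Set
open scoped SchwartzMap FourierTransform

noncomputable section

/-- The Bessel function of the first kind `J_ν`, for a real order `ν` and an argument `z ≥ 0`:
`J_ν(z) = (z/2)^ν ∑_{m ≥ 0} (-1)^m / (m! Γ(m + ν + 1)) (z/2)^{2m}`. -/
def besselJ (ν z : ℝ) : ℝ :=
  (z / 2) ^ ν *
    ∑' m : ℕ, (-1 : ℝ) ^ m / ((m.factorial : ℝ) * Real.Gamma (m + ν + 1)) * (z / 2) ^ (2 * m)

/-- The surface area `S_n = 2 π^{(n+1)/2} / Γ((n+1)/2)` of the unit `n`-sphere in `ℝ^{n+1}`. -/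
def sphereArea (n : ℕ) : ℝ :=
  2 * Real.pi ^ (((n : ℝ) + 1) / 2) / Real.Gamma (((n : ℝ) + 1) / 2)

/-- The fractional Laplacian `(-Δ)^α` of a Schwartz function: the Fourier multiplier with symbol
`|κ|^{2α}` in the angular frequency `κ`. Mathlib's Fourier transform uses `exp (-2πi⟨x, ξ⟩)`,
so `κ = 2πξ`. -/
def fracLaplacian {d : ℕ} (α : ℝ) (φ : 𝓢(EuclideanSpace ℝ (Fin d), ℂ)) :
    EuclideanSpace ℝ (Fin d) → ℂ :=
  𝓕⁻ (fun ξ : EuclideanSpace ℝ (Fin d) =>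
    (((2 * Real.pi * ‖ξ‖) ^ (2 * α) : ℝ) : ℂ) * 𝓕 (φ : EuclideanSpace ℝ (Fin d) → ℂ) ξ)

/-- The formal adjoint `b · ∇φ + D_o Δφ - D_f (-Δ)^α φ` of the spatial operator
`-b · ∇ + D_o Δ - D_f (-Δ)^α`, applied to a test function. -/
def ffpeAdjoint {d : ℕ} (b : EuclideanSpace ℝ (Fin d)) (Do Df α : ℝ)
    (φ : 𝓢(EuclideanSpace ℝ (Fin d), ℂ)) (x : EuclideanSpace ℝ (Fin d)) : ℂ :=
  fderiv ℝ φ x b + (Do : ℂ) * Laplacian.laplacian (φ : EuclideanSpace ℝ (Fin d) → ℂ) x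
    - (Df : ℂ) * fracLaplacian α φ x

/-- `p` is a fundamental solution of the fractional Fokker-Planck equation
`∂ₜ p = -b · ∇p + D_o Δp - D_f (-Δ)^α p` on `ℝ^d × (0, ∞)` with `p(·, 0) = δ_{x₀}`:
for `t > 0`, `p(·, t)` is a continuous probability density, the equation holds in the sense of
tempered distributions, and `p(·, t) → δ_{x₀}` in that sense as `t → 0+`. -/
structure IsFundamentalSolution {d : ℕ} (b x₀ : EuclideanSpace ℝ (Fin d)) (Do Df α : ℝ)
    (p : EuclideanSpace ℝ (Fin d) → ℝ → ℝ) : Prop where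
  continuous : ∀ t : ℝ, 0 < t → Continuous fun x => p x t
  nonneg : ∀ t : ℝ, 0 < t → ∀ x, 0 ≤ p x t
  integrable : ∀ t : ℝ, 0 < t → Integrable fun x => p x t
  mass : ∀ t : ℝ, 0 < t → ∫ x, p x t = 1
  equation : ∀ (φ : 𝓢(EuclideanSpace ℝ (Fin d), ℂ)) (t : ℝ), 0 < t →
    HasDerivAt (fun s : ℝ => ∫ x, (p x s : ℂ) * φ x)
      (∫ x, (p x t : ℂ) * ffpeAdjoint b Do Df α φ x) t
  initial : ∀ φ : 𝓢(EuclideanSpace ℝ (Fin d), ℂ),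
    Tendsto (fun t : ℝ => ∫ x, (p x t : ℂ) * φ x) (𝓝[>] 0) (𝓝 (φ x₀))

end

/-!
The equation is solved on the Fourier side. Write `ffpeSymbol ξ = 2πi⟨ξ, b⟩ - ψ(2π‖ξ‖)` with
`ψ(r) = D_o r² + D_f r^{2α}`. The adjoint operator acts on Schwartz functions as the Fourier
multiplier with this symbol (`ffpeAdjoint_eq_fourierInv`), so the characteristic function of a
solution at time `t` has to be `ffpeFourier t ξ = exp (2πi⟨ξ, x₀⟩ + t * ffpeSymbol ξ)`.

*Uniqueness.* For a fundamental solution `p` and a frequency `ξ₀`, test the equation against the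
inverse Fourier transforms of an approximate identity at `ξ₀`. These functions, and their images
under the adjoint operator, converge boundedly to `e(x) = exp (2πi⟨x, ξ₀⟩)` and to
`ffpeSymbol ξ₀ * e(x)`, so that `q(t) = ∫ p(x, t) e(x) dx` solves `q' = ffpeSymbol ξ₀ * q` with
`q(0+) = e(x₀)` (`eq_exp_mul_of_tendsto_hasDerivAt`, `IsFundamentalSolution.fourierInv_eq`).
Since `ffpeFourier t` is integrable and `p` is continuous, Fourier inversion determines `p`.

*Existence.* The candidate `ffpeDensity` is the Fourier transform of `ffpeFourier t`. Its
nonnegativity is the main point, as it states that a rotationally symmetric stable law exists.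
Call a multiplier `GaussianPositive` if its product with every Gaussian has a nonnegative cosine
transform. This class contains `1`, and it is closed under multiplication by Laplace transforms
in `‖ξ‖²` of nonnegative densities, under sums, and under bounded limits; hence it contains
`exp h` for every such Laplace transform `h`. Because `l ^ α` is proportional to
`∫_0^∞ (1 - exp (-u l)) u ^ (-1 - α) du`, cutting this integral off at a small `ε` exhibits
`exp (-τ ‖ξ‖ ^ (2α))` as a limit of such exponentials (`GaussianPositive.exp_neg_rpow`). A
nonnegative Fourier transform of a continuous integrable function is integrable by Fatou's lemma
(`integrable_of_nonneg_of_eq_fourier`), and inversion then gives the mass and the equation.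

*Formulas.* In polar coordinates the density is an integral over `r` of the Fourier transform of
the surface measure of the sphere. The power series `sphereTransform` of the latter follows from
the moments of a coordinate on the sphere, which are quotients of Gaussian integrals
(`integral_sphere_coord_pow`, `integral_sphere_cos`, `integral_radial_mul_cos`). Up to a power of
its argument it is the series of `J_{d/2-1}`; it is `2 cos` for `d = 1`, and its value at `0` is
the area of the sphere.
-/

/-! ### Polar coordinates and Gaussian moments -/

section Polar
variable {V : Type*} [NormedAddCommGroup V] [InnerProductSpace ℝ V] [FiniteDimensional ℝ V]
  [MeasurableSpace V] [BorelSpace V] [Nontrivial V]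

/-- Integration in polar coordinates for an integrable, not necessarily radial, function. -/
theorem integrable_polar_and_integral_eq {f : V → ℝ} (hf : Integrable f) :
    IntegrableOn (fun r : ℝ => r ^ (Module.finrank ℝ V - 1) *
      ∫ ω : Metric.sphere (0 : V) 1, f (r • (ω : V)) ∂(volume : Measure V).toSphere) (Ioi 0) ∧
    ∫ x, f x = ∫ r in Ioi (0 : ℝ), r ^ (Module.finrank ℝ V - 1) *
      ∫ ω : Metric.sphere (0 : V) 1, f (r • (ω : V)) ∂(volume : Measure V).toSphere := by
  set n := Module.finrank ℝ V - 1
  set σ := (volume : Measure V).toSphere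
  have hmp := (volume : Measure V).measurePreserving_homeomorphUnitSphereProd
  have hemb := (homeomorphUnitSphereProd V).measurableEmbedding
  set F : Metric.sphere (0 : V) 1 × Ioi (0 : ℝ) → ℝ := fun p => f (p.2.1 • (p.1 : V))
  have hF (x : ({0}ᶜ : Set V)) : F (homeomorphUnitSphereProd V x) = f x := by
    have hx : ‖(x : V)‖ ≠ 0 := norm_ne_zero_iff.2 x.2
    simp [F, smul_smul, mul_inv_cancel₀ hx]
  have hFi : Integrable F (σ.prod (Measure.volumeIoiPow n)) := by
    rw [← hmp.integrable_comp_emb hemb]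
    have : IntegrableOn f ({0}ᶜ : Set V) := hf.integrableOn
    rw [integrableOn_iff_comap_subtypeVal (measurableSet_singleton _).compl] at this
    exact this.congr (.of_forall fun x => (hF x).symm)
  have hFe : ∫ x, f x = ∫ p, F p ∂(σ.prod (Measure.volumeIoiPow n)) := by
    rw [← hmp.integral_comp hemb]
    simp only [hF]
    rw [integral_subtype_comap (measurableSet_singleton _).compl f, restrict_compl_singleton]
  have h1 := hFi.integral_prod_right
  have h2 := integral_prod_symm F hFi
  simp only [F] at h1 h2
  set g : ℝ → ℝ := fun r => ∫ ω : Metric.sphere (0 : V) 1, f (r • (ω : V)) ∂σ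
  constructor
  · rw [Measure.volumeIoiPow, integrable_withDensity_iff_integrable_smul' (by fun_prop)
      (by simp)] at h1
    rw [integrableOn_iff_comap_subtypeVal measurableSet_Ioi]
    refine h1.congr (.of_forall fun r => ?_)
    simp only [Function.comp_apply, smul_eq_mul]
    rw [ENNReal.toReal_ofReal (pow_nonneg (le_of_lt r.2) _)]
  · rw [hFe, h2, Measure.volumeIoiPow]
    unfold ENNReal.ofReal
    rw [integral_withDensity_eq_integral_smul (by fun_prop),
      integral_subtype_comap measurableSet_Ioi fun a : ℝ => Real.toNNReal (a ^ n) • g a]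
    refine setIntegral_congr_fun measurableSet_Ioi fun x hx => ?_
    simp only [NNReal.smul_def, smul_eq_mul]
    rw [Real.coe_toNNReal _ (pow_nonneg hx.out.le _)]

end Polar

theorem integral_even_pow_mul_exp_neg_sq (m : ℕ) :
    ∫ x : ℝ, x ^ (2 * m) * Real.exp (-x ^ 2) = Real.Gamma (m + 1 / 2) := by
  have h := integral_comp_abs (f := fun x : ℝ => x ^ (2 * m) * Real.exp (-x ^ 2))
  have h2 := integral_rpow_mul_exp_neg_rpow (p := 2) (q := 2 * m) two_pos
    (by have : (0:ℝ) ≤ m := m.cast_nonneg; linarith)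
  have e : ∀ x : ℝ, |x| ^ (2 * m) = x ^ (2 * m) := fun x => by rw [pow_mul, sq_abs, ← pow_mul]
  simp only [sq_abs, e] at h
  rw [h]
  have : ∫ x in Ioi (0:ℝ), x ^ (2 * m) * Real.exp (-x ^ 2) =
      ∫ x in Ioi (0:ℝ), x ^ (2 * (m:ℝ)) * Real.exp (-x ^ (2:ℝ)) := by
    refine setIntegral_congr_fun measurableSet_Ioi fun x hx => ?_
    rw [Real.rpow_two]
    congr 1
    exact_mod_cast (Real.rpow_natCast x (2 * m)).symm
  rw [this, h2]
  rw [← mul_assoc]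
  norm_num
  congr 1; ring

theorem integral_coord_pow_mul_gaussian {d : ℕ} (i : Fin d) (m : ℕ) :
    Integrable (fun x : EuclideanSpace ℝ (Fin d) => x i ^ (2 * m) * Real.exp (-‖x‖ ^ 2)) ∧
    ∫ x : EuclideanSpace ℝ (Fin d), x i ^ (2 * m) * Real.exp (-‖x‖ ^ 2) =
      Real.Gamma (m + 1 / 2) * Real.sqrt Real.pi ^ (d - 1) := by
  -- The integrand is a product over the coordinates, so Fubini reduces to one-variable integrals.
  set f : Fin d → ℝ → ℝ := fun j y => (if j = i then y ^ (2 * m) else 1) * Real.exp (-y ^ 2)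
  have hf (x : Fin d → ℝ) : ∏ j, f j (x j) =
      (WithLp.toLp 2 x : EuclideanSpace ℝ (Fin d)) i ^ (2 * m) *
        Real.exp (-‖(WithLp.toLp 2 x : EuclideanSpace ℝ (Fin d))‖ ^ 2) := by
    simp only [f, Finset.prod_mul_distrib, Finset.prod_ite_eq', Finset.mem_univ, if_true]
    rw [← Real.exp_sum, EuclideanSpace.real_norm_sq_eq, Finset.sum_neg_distrib]
  have hfi (j : Fin d) : Integrable (f j) := by
    by_cases hj : j = i
    · simp only [f, hj, if_true]
      have := integrable_rpow_mul_exp_neg_mul_sq (b := 1) one_pos (s := 2 * m)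
        (by have : (0:ℝ) ≤ m := m.cast_nonneg; linarith)
      refine this.congr (.of_forall fun x => ?_)
      simp only [neg_mul, one_mul]
      congr 1
      exact_mod_cast (Real.rpow_natCast x (2 * m))
    · simpa [f, hj] using integrable_exp_neg_mul_sq (b := 1) one_pos
  have hmp := (EuclideanSpace.volume_preserving_symm_measurableEquiv_toLp (Fin d)).symm
  constructor
  · rw [← hmp.integrable_comp_emb (MeasurableEquiv.measurableEmbedding _)]
    refine (Integrable.fintype_prod hfi).congr (.of_forall fun x => ?_)
    simpa using hf x
  · rw [← hmp.integral_comp (MeasurableEquiv.measurableEmbedding _)]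
    trans ∫ x : Fin d → ℝ, ∏ j, f j (x j)
    · exact integral_congr_ae (.of_forall fun x => (hf x).symm)
    rw [integral_fintype_prod_volume_eq_prod, ← Finset.mul_prod_erase _ _ (Finset.mem_univ i)]
    have h0 : ∫ y, f i y = Real.Gamma (m + 1 / 2) := by
      simp only [f, if_true]; exact integral_even_pow_mul_exp_neg_sq m
    rw [h0, Finset.prod_congr rfl (g := fun _ => Real.sqrt Real.pi), Finset.prod_const,
      Finset.card_erase_of_mem (Finset.mem_univ i), Finset.card_univ, Fintype.card_fin]
    intro j hj
    have := integral_gaussian 1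
    simp [f, Finset.ne_of_mem_erase hj] at this ⊢
    exact this

/-! ### The Fourier transform of the surface measure of the sphere -/

/-- Legendre's duplication formula at half-integers. -/
theorem gamma_natCast_add_half (m : ℕ) :
    Real.Gamma (m + 1 / 2) =
      (2 * m).factorial * Real.sqrt Real.pi / (4 ^ m * m.factorial) := by
  have h := Real.Gamma_mul_Gamma_add_half (m + 1 / 2)
  rw [show (m : ℝ) + 1 / 2 + 1 / 2 = m + 1 by ring, Real.Gamma_nat_eq_factorial,
    show 2 * ((m : ℝ) + 1 / 2) = (2 * m : ℕ) + 1 by push_cast; ring,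
    Real.Gamma_nat_eq_factorial,
    show (1 : ℝ) - ((2 * m : ℕ) + 1) = -((2 * m : ℕ) : ℝ) by ring, Real.rpow_neg two_pos.le,
    Real.rpow_natCast, pow_mul] at h
  norm_num at h ⊢
  have : (m.factorial : ℝ) ≠ 0 := by positivity
  field_simp at h ⊢
  linarith

theorem integral_pow_mul_exp_neg_sq (k : ℕ) :
    ∫ r in Ioi (0 : ℝ), r ^ k * Real.exp (-r ^ 2) = Real.Gamma ((k + 1) / 2) / 2 := by
  have h2 := integral_rpow_mul_exp_neg_rpow (p := 2) (q := k) two_pos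
    (by have : (0:ℝ) ≤ k := k.cast_nonneg; linarith)
  simp only [Real.rpow_natCast, Real.rpow_two] at h2
  rw [h2]; ring

/-- The even moments of a coordinate on the unit sphere, obtained by writing the Gaussian moment
`∫ x_i ^ (2m) exp (-‖x‖²)` in polar coordinates. -/
theorem integral_sphere_coord_pow {d : ℕ} [NeZero d] (i : Fin d) (m : ℕ) :
    ∫ ω : Metric.sphere (0 : EuclideanSpace ℝ (Fin d)) 1, (ω : EuclideanSpace ℝ (Fin d)) i ^ (2 * m)
      ∂(volume : Measure (EuclideanSpace ℝ (Fin d))).toSphere =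
    2 * Real.sqrt Real.pi ^ (d - 1) * Real.Gamma (m + 1 / 2) / Real.Gamma (m + d / 2) := by
  obtain ⟨hi, hint⟩ := integral_coord_pow_mul_gaussian i m
  have hp := (integrable_polar_and_integral_eq hi).2
  rw [hint, finrank_euclideanSpace_fin] at hp
  have hd : 1 ≤ d := NeZero.one_le
  have hG : 0 < Real.Gamma (m + d / 2) := by
    have : (1:ℝ) ≤ d := by exact_mod_cast hd
    exact Real.Gamma_pos_of_pos (by positivity)
  set M := ∫ ω : Metric.sphere (0 : EuclideanSpace ℝ (Fin d)) 1,
    (ω : EuclideanSpace ℝ (Fin d)) i ^ (2 * m)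
      ∂(volume : Measure (EuclideanSpace ℝ (Fin d))).toSphere with hM
  have : ∀ r ∈ Ioi (0 : ℝ), r ^ (d - 1) *
      ∫ ω : Metric.sphere (0 : EuclideanSpace ℝ (Fin d)) 1,
        ((r • (ω : EuclideanSpace ℝ (Fin d))) i ^ (2 * m) *
          Real.exp (-‖r • (ω : EuclideanSpace ℝ (Fin d))‖ ^ 2))
        ∂(volume : Measure (EuclideanSpace ℝ (Fin d))).toSphere =
      M * (r ^ (d - 1 + 2 * m) * Real.exp (-r ^ 2)) := by
    intro r hr
    have h1 : ∀ ω : Metric.sphere (0 : EuclideanSpace ℝ (Fin d)) 1,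
        ((r • (ω : EuclideanSpace ℝ (Fin d))) i ^ (2 * m) *
          Real.exp (-‖r • (ω : EuclideanSpace ℝ (Fin d))‖ ^ 2)) =
        (r ^ (2 * m) * Real.exp (-r ^ 2)) * (ω : EuclideanSpace ℝ (Fin d)) i ^ (2 * m) := by
      intro ω
      rw [norm_smul, norm_eq_of_mem_sphere, mul_one, Real.norm_eq_abs, sq_abs, PiLp.smul_apply,
        smul_eq_mul, mul_pow]
      ring
    simp_rw [h1]
    rw [integral_const_mul, ← hM, pow_add]; ring
  rw [setIntegral_congr_fun measurableSet_Ioi this, integral_const_mul,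
    integral_pow_mul_exp_neg_sq,
    show (((d - 1 + 2 * m : ℕ) : ℝ) + 1) / 2 = m + d / 2 by
      push_cast [Nat.cast_sub hd]; ring] at hp
  rw [eq_div_iff hG.ne']
  linarith

/-- The Fourier transform of the surface measure of the unit sphere of `ℝ^d`, as a function of
the modulus `u` of the angular frequency, written as a power series. For `u > 0` it equals
`(2π)^{d/2} u^{1-d/2} J_{d/2-1}(u)`. -/
noncomputable def sphereTransform (d : ℕ) (u : ℝ) : ℝ :=
  ∑' m : ℕ, (-1 : ℝ) ^ m * (2 * Real.pi ^ ((d : ℝ) / 2) /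
    ((m.factorial : ℝ) * Real.Gamma (m + d / 2))) * (u / 2) ^ (2 * m)

/-- The cosine series may be integrated term by term over the sphere. -/
theorem integral_sphere_cos {d : ℕ} [NeZero d] (i : Fin d) (u : ℝ) :
    ∫ ω : Metric.sphere (0 : EuclideanSpace ℝ (Fin d)) 1,
      Real.cos (u * (ω : EuclideanSpace ℝ (Fin d)) i)
      ∂(volume : Measure (EuclideanSpace ℝ (Fin d))).toSphere = sphereTransform d u := by
  have hd : 1 ≤ d := NeZero.one_le
  set σ := (volume : Measure (EuclideanSpace ℝ (Fin d))).toSphere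
  let F : ℕ → Metric.sphere (0 : EuclideanSpace ℝ (Fin d)) 1 → ℝ := fun m ω =>
    (-1) ^ m * (u * (ω : EuclideanSpace ℝ (Fin d)) i) ^ (2 * m) / (2 * m).factorial
  have hle (ω : Metric.sphere (0 : EuclideanSpace ℝ (Fin d)) 1) :
      |(ω : EuclideanSpace ℝ (Fin d)) i| ≤ 1 := by
    have := PiLp.norm_apply_le (ω : EuclideanSpace ℝ (Fin d)) i
    rwa [norm_eq_of_mem_sphere] at this
  have hb (m : ℕ) (ω) : ‖F m ω‖ ≤ |u| ^ (2 * m) / (2 * m).factorial := by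
    simp only [F, norm_div, norm_mul, norm_pow, norm_neg, norm_one, one_pow, one_mul,
      Real.norm_eq_abs, Nat.abs_cast, mul_pow]
    gcongr
    exact mul_le_of_le_one_right (by positivity) (pow_le_one₀ (abs_nonneg _) (hle ω))
  have hFc (m : ℕ) : Continuous (F m) := by
    have : Continuous fun ω : Metric.sphere (0 : EuclideanSpace ℝ (Fin d)) 1 =>
      (ω : EuclideanSpace ℝ (Fin d)) i :=
      (EuclideanSpace.proj (𝕜 := ℝ) i).continuous.comp continuous_subtype_val
    simp only [F]; fun_prop
  have hFi (m : ℕ) : Integrable (F m) σ :=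
    (integrable_const (|u| ^ (2 * m) / (2 * m).factorial)).mono' (hFc m).aestronglyMeasurable
      (.of_forall (hb m))
  have hsum : Summable fun m => ∫ ω, ‖F m ω‖ ∂σ := by
    have h0 : Summable fun m : ℕ => |u| ^ (2 * m) / (2 * m).factorial :=
      (Real.summable_pow_div_factorial |u|).comp_injective
        (mul_right_injective₀ (two_ne_zero))
    refine Summable.of_nonneg_of_le (fun m => integral_nonneg fun _ => norm_nonneg _)
      (fun m => ?_) (h0.mul_right (σ.real univ))
    refine (integral_mono (hFi m).norm (integrable_const _) (hb m)).trans ?_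
    rw [integral_const, smul_eq_mul, mul_comm]
  have hs := hasSum_integral_of_summable_integral_norm hFi hsum
  have : ∀ ω, ∑' m, F m ω = Real.cos (u * (ω : EuclideanSpace ℝ (Fin d)) i) :=
    fun ω => (Real.cos_eq_tsum _).symm
  simp_rw [this] at hs
  rw [← hs.tsum_eq, sphereTransform]
  congr 1 with m
  have h1 : ∀ ω, F m ω = ((-1) ^ m * u ^ (2 * m) / (2 * m).factorial) *
      (ω : EuclideanSpace ℝ (Fin d)) i ^ (2 * m) := fun ω => by
    simp only [F, mul_pow]; ring
  simp_rw [h1]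
  have hG : 0 < Real.Gamma (m + d / 2) := by
    have : (1:ℝ) ≤ d := by exact_mod_cast hd
    exact Real.Gamma_pos_of_pos (by positivity)
  rw [integral_const_mul, integral_sphere_coord_pow, gamma_natCast_add_half]
  have hpi : Real.sqrt Real.pi ^ (d - 1) * Real.sqrt Real.pi = Real.pi ^ ((d : ℝ) / 2) := by
    rw [← pow_succ, Nat.sub_add_cancel hd, Real.sqrt_eq_rpow, ← Real.rpow_natCast,
      ← Real.rpow_mul Real.pi_pos.le]
    congr 1; ring
  rw [← hpi, div_pow, pow_mul 2]
  norm_num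
  have : (m.factorial : ℝ) ≠ 0 := by positivity
  have : ((2 * m).factorial : ℝ) ≠ 0 := by positivity
  field_simp

theorem sphereTransform_zero (d : ℕ) :
    sphereTransform d 0 = 2 * Real.pi ^ ((d : ℝ) / 2) / Real.Gamma (d / 2) := by
  rw [sphereTransform, tsum_eq_single 0]
  · simp
  · intro m hm
    simp [hm]

theorem sphereTransform_one (u : ℝ) : sphereTransform 1 u = 2 * Real.cos u := by
  rw [sphereTransform, Real.cos_eq_tsum, ← tsum_mul_left]
  congr 1 with m
  rw [Nat.cast_one, gamma_natCast_add_half, ← Real.sqrt_eq_rpow, div_pow, pow_mul 2]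
  norm_num
  have : (m.factorial : ℝ) ≠ 0 := by positivity
  have : ((2 * m).factorial : ℝ) ≠ 0 := by positivity
  have : Real.sqrt Real.pi ≠ 0 := (Real.sqrt_pos.2 Real.pi_pos).ne'
  field_simp

theorem besselJ_eq_sphereTransform (d : ℕ) (u : ℝ) :
    besselJ (((d : ℝ) - 2) / 2) u =
      (u / 2) ^ (((d : ℝ) - 2) / 2) * sphereTransform d u / (2 * Real.pi ^ ((d : ℝ) / 2)) := by
  rw [besselJ, mul_div_assoc, sphereTransform, ← tsum_div_const]
  congr 2 with m
  rw [show (m : ℝ) + ((d : ℝ) - 2) / 2 + 1 = m + d / 2 by ring]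
  have : Real.pi ^ ((d : ℝ) / 2) ≠ 0 := (Real.rpow_pos_of_pos Real.pi_pos _).ne'
  field_simp

/-- The Fourier integral of a radial function on `ℝ^d`, in polar coordinates. -/
theorem integral_radial_mul_cos {d : ℕ} [NeZero d] {g : ℝ → ℝ}
    (hg : Integrable fun ξ : EuclideanSpace ℝ (Fin d) => g ‖ξ‖) (z : EuclideanSpace ℝ (Fin d)) :
    IntegrableOn (fun r : ℝ => r ^ (d - 1) * (g r * sphereTransform d (2 * Real.pi * r * ‖z‖)))
      (Ioi 0) ∧
    ∫ ξ : EuclideanSpace ℝ (Fin d), g ‖ξ‖ * Real.cos (2 * Real.pi * inner ℝ ξ z) =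
      ∫ r in Ioi (0 : ℝ), r ^ (d - 1) * (g r * sphereTransform d (2 * Real.pi * r * ‖z‖)) := by
  -- A reflection exchanging `z` with a multiple of a basis vector reduces to that direction.
  set w : EuclideanSpace ℝ (Fin d) := EuclideanSpace.single 0 ‖z‖
  have hw : ‖z‖ = ‖w‖ := by simp [w]
  set R := Submodule.reflection (Submodule.span ℝ {z - w})ᗮ
  have hR : R z = w := Submodule.reflection_sub hw
  have hrot : ∫ ξ : EuclideanSpace ℝ (Fin d), g ‖ξ‖ * Real.cos (2 * Real.pi * inner ℝ ξ z) =
      ∫ ξ : EuclideanSpace ℝ (Fin d), g ‖ξ‖ * Real.cos (2 * Real.pi * inner ℝ ξ w) := by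
    rw [← R.measurePreserving.integral_comp R.toHomeomorph.measurableEmbedding
      (fun ξ => g ‖ξ‖ * Real.cos (2 * Real.pi * inner ℝ ξ w))]
    simp_rw [← hR, LinearIsometryEquiv.norm_map, LinearIsometryEquiv.inner_map_map]
  have hi : Integrable fun ξ : EuclideanSpace ℝ (Fin d) =>
      g ‖ξ‖ * Real.cos (2 * Real.pi * inner ℝ ξ w) := by
    refine hg.mul_bdd (c := 1) (by fun_prop) (.of_forall fun ξ => ?_)
    exact Real.abs_cos_le_one _
  obtain ⟨h1, h2⟩ := integrable_polar_and_integral_eq hi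
  rw [finrank_euclideanSpace_fin] at h1 h2
  have key : EqOn (fun r : ℝ => r ^ (d - 1) *
      ∫ ω : Metric.sphere (0 : EuclideanSpace ℝ (Fin d)) 1,
        (g ‖r • (ω : EuclideanSpace ℝ (Fin d))‖ *
          Real.cos (2 * Real.pi * inner ℝ (r • (ω : EuclideanSpace ℝ (Fin d))) w))
        ∂(volume : Measure (EuclideanSpace ℝ (Fin d))).toSphere)
      (fun r : ℝ => r ^ (d - 1) * (g r * sphereTransform d (2 * Real.pi * r * ‖z‖))) (Ioi 0) := by
    intro r hr
    have : ∀ ω : Metric.sphere (0 : EuclideanSpace ℝ (Fin d)) 1,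
        g ‖r • (ω : EuclideanSpace ℝ (Fin d))‖ *
          Real.cos (2 * Real.pi * inner ℝ (r • (ω : EuclideanSpace ℝ (Fin d))) w) =
        g r * Real.cos ((2 * Real.pi * r * ‖z‖) * (ω : EuclideanSpace ℝ (Fin d)) 0) := by
      intro ω
      rw [norm_smul, norm_eq_of_mem_sphere, mul_one, Real.norm_eq_abs, abs_of_pos hr,
        inner_smul_left, EuclideanSpace.inner_single_right]
      simp
      ring_nf
      simp
    simp only [this, integral_const_mul, integral_sphere_cos]
  exact ⟨h1.congr_fun key measurableSet_Ioi, by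
    rw [hrot, h2, setIntegral_congr_fun measurableSet_Ioi key]⟩

/-! ### Gaussian-positive multipliers -/

section Positivity
variable {V : Type*} [NormedAddCommGroup V] [InnerProductSpace ℝ V] [FiniteDimensional ℝ V]
  [MeasurableSpace V] [BorelSpace V]

theorem integrable_exp_neg_mul_norm_sq {s : ℝ} (hs : 0 < s) :
    Integrable fun ξ : V => Real.exp (-s * ‖ξ‖ ^ 2) := by
  have h := (GaussianFourier.integrable_cexp_neg_mul_sq_norm_add (V := V) (b := (s : ℂ))
    (by simpa using hs) 0 0).norm
  refine h.congr (.of_forall fun ξ => ?_)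
  simp only [Complex.norm_exp]
  norm_cast
  simp

/-- A multiplier `f` is Gaussian-positive if, after damping by any Gaussian, its (cosine) Fourier
transform is nonnegative. For bounded continuous even `f` this amounts to
positive-definiteness in the sense of Bochner. -/
def GaussianPositive (f : V → ℝ) : Prop :=
  ∀ s : ℝ, 0 < s → ∀ x : V,
    0 ≤ ∫ ξ, f ξ * (Real.exp (-s * ‖ξ‖ ^ 2) * Real.cos (2 * Real.pi * inner ℝ ξ x))

theorem integrable_exp_mul_cos {s : ℝ} (hs : 0 < s) (x : V) :
    Integrable fun ξ : V =>
      Real.exp (-s * ‖ξ‖ ^ 2) * Real.cos (2 * Real.pi * inner ℝ ξ x) :=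
  (integrable_exp_neg_mul_norm_sq hs).mul_bdd (c := 1) (by fun_prop)
    (.of_forall fun _ => Real.abs_cos_le_one _)

namespace GaussianPositive

/-- The Fourier transform of a Gaussian is a Gaussian. -/
theorem one : GaussianPositive fun _ : V => 1 := by
  intro s hs x
  have h := fourier_gaussian_innerProductSpace (V := V) (b := (s : ℂ)) (by simpa using hs) x
  rw [Real.fourier_eq'] at h
  have hre := congrArg Complex.re h
  have hi : Integrable fun ξ : V => Complex.exp (↑(-2 * Real.pi * inner ℝ ξ x) * Complex.I) •
      Complex.exp (-(s : ℂ) * ‖ξ‖ ^ 2) := by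
    have := GaussianFourier.integrable_cexp_neg_mul_sq_norm_add (V := V) (b := (s : ℂ))
      (by simpa using hs) (-2 * Real.pi * Complex.I) x
    refine this.congr (.of_forall fun ξ => ?_)
    simp only [smul_eq_mul, ← Complex.exp_add, real_inner_comm ξ x]
    push_cast; ring_nf
  have h2 := integral_re hi
  simp only [RCLike.re_eq_complex_re] at h2
  rw [← h2] at hre
  have e : ∀ ξ : V, (Complex.exp (↑(-2 * Real.pi * inner ℝ ξ x) * Complex.I) •
      Complex.exp (-(s : ℂ) * ‖ξ‖ ^ 2)).re =
      1 * (Real.exp (-s * ‖ξ‖ ^ 2) * Real.cos (2 * Real.pi * inner ℝ ξ x)) := by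
    intro ξ
    have : Complex.exp (-(s : ℂ) * ‖ξ‖ ^ 2) = (Real.exp (-s * ‖ξ‖ ^ 2) : ℝ) := by push_cast; rfl
    rw [this, smul_eq_mul, Complex.re_mul_ofReal, Complex.exp_ofReal_mul_I_re, one_mul, mul_comm,
      ← Real.cos_neg]
    ring_nf
  simp_rw [e] at hre
  rw [hre]
  have e2 : ((Real.pi : ℂ) / s) ^ (Module.finrank ℝ V / 2 : ℂ) *
      Complex.exp (-Real.pi ^ 2 * ‖x‖ ^ 2 / s) =
      (((Real.pi / s) ^ ((Module.finrank ℝ V : ℝ) / 2) *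
        Real.exp (-Real.pi ^ 2 * ‖x‖ ^ 2 / s) : ℝ) : ℂ) := by
    push_cast
    rw [Complex.ofReal_cpow (by positivity)]
    push_cast; rfl
  rw [e2, Complex.ofReal_re]
  positivity

theorem of_tendsto {f : ℕ → V → ℝ} {g : V → ℝ} {C : ℝ} (hf : ∀ n, GaussianPositive (f n))
    (hm : ∀ n, Measurable (f n)) (hb : ∀ n ξ, |f n ξ| ≤ C)
    (hlim : ∀ ξ, Tendsto (fun n => f n ξ) atTop (𝓝 (g ξ))) : GaussianPositive g := by
  intro s hs x
  refine ge_of_tendsto' (tendsto_integral_of_dominated_convergence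
    (fun ξ => C * Real.exp (-s * ‖ξ‖ ^ 2)) (fun n => ?_)
    ((integrable_exp_neg_mul_norm_sq hs).const_mul C) (fun n => .of_forall fun ξ => ?_)
    (.of_forall fun ξ => (hlim ξ).mul_const _)) (fun n => hf n s hs x)
  · exact (hm n).aestronglyMeasurable.mul (by fun_prop)
  · rw [norm_mul, norm_mul, Real.norm_eq_abs, Real.norm_eq_abs, Real.norm_eq_abs, Real.abs_exp]
    gcongr
    · exact (abs_nonneg _).trans (hb n ξ)
    · exact hb n ξ
    · exact mul_le_of_le_one_right (Real.exp_pos _).le (Real.abs_cos_le_one _)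

theorem mul_exp {f : V → ℝ} (hf : GaussianPositive f) {a : ℝ} (ha : 0 ≤ a) :
    GaussianPositive fun ξ => f ξ * Real.exp (-a * ‖ξ‖ ^ 2) := by
  intro s hs x
  refine (hf (a + s) (by linarith) x).trans_eq (integral_congr_ae (.of_forall fun ξ => ?_))
  simp only
  rw [show -(a + s) * ‖ξ‖ ^ 2 = -a * ‖ξ‖ ^ 2 + -s * ‖ξ‖ ^ 2 by ring, Real.exp_add]
  ring

/-- Multiplication by `∫ w(u) exp (-u ‖ξ‖²) du` with `w ≥ 0` averages over the damping Gaussian. -/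
theorem mul_laplace {f : V → ℝ} (hf : GaussianPositive f) (hm : Measurable f) {C : ℝ}
    (hb : ∀ ξ, |f ξ| ≤ C) {ε : ℝ} (hε : 0 ≤ ε) {w : ℝ → ℝ} (hw : IntegrableOn w (Ioi ε))
    (hw0 : ∀ u ∈ Ioi ε, 0 ≤ w u) :
    GaussianPositive fun ξ => f ξ * ∫ u in Ioi ε, w u * Real.exp (-u * ‖ξ‖ ^ 2) := by
  intro s hs x
  have hi : Integrable (fun ξ : V => f ξ *
      (Real.exp (-s * ‖ξ‖ ^ 2) * Real.cos (2 * Real.pi * inner ℝ ξ x))) :=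
    (integrable_exp_mul_cos hs x).bdd_mul (c := C) hm.aestronglyMeasurable (.of_forall hb)
  have hprod : Integrable (fun p : V × ℝ => (f p.1 *
      (Real.exp (-s * ‖p.1‖ ^ 2) * Real.cos (2 * Real.pi * inner ℝ p.1 x)) * w p.2) *
      Real.exp (-p.2 * ‖p.1‖ ^ 2)) (volume.prod (volume.restrict (Ioi ε))) := by
    refine (hi.mul_prod hw).mul_bdd (c := 1) (by fun_prop) ?_
    filter_upwards [Measure.quasiMeasurePreserving_snd.ae (ae_restrict_mem measurableSet_Ioi)]
      with p hp
    rw [Real.norm_eq_abs, Real.abs_exp, Real.exp_le_one_iff]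
    have : 0 < p.2 := hε.trans_lt hp
    nlinarith [sq_nonneg ‖p.1‖]
  have hswap := integral_integral_swap (f := fun (ξ : V) (u : ℝ) => (f ξ *
      (Real.exp (-s * ‖ξ‖ ^ 2) * Real.cos (2 * Real.pi * inner ℝ ξ x)) * w u) *
      Real.exp (-u * ‖ξ‖ ^ 2)) hprod
  have hL : ∫ ξ, (f ξ * ∫ u in Ioi ε, w u * Real.exp (-u * ‖ξ‖ ^ 2)) *
      (Real.exp (-s * ‖ξ‖ ^ 2) * Real.cos (2 * Real.pi * inner ℝ ξ x)) =
      ∫ ξ, ∫ u in Ioi ε, (f ξ *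
      (Real.exp (-s * ‖ξ‖ ^ 2) * Real.cos (2 * Real.pi * inner ℝ ξ x)) * w u) *
      Real.exp (-u * ‖ξ‖ ^ 2) := by
    congr 1 with ξ
    simp_rw [mul_assoc (f ξ * _)]
    rw [integral_const_mul]; ring
  rw [hL, hswap]
  refine setIntegral_nonneg measurableSet_Ioi fun u hu => ?_
  have : ∫ ξ, (f ξ * (Real.exp (-s * ‖ξ‖ ^ 2) * Real.cos (2 * Real.pi * inner ℝ ξ x)) * w u) *
      Real.exp (-u * ‖ξ‖ ^ 2) = w u * ∫ ξ, (f ξ * Real.exp (-u * ‖ξ‖ ^ 2)) *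
      (Real.exp (-s * ‖ξ‖ ^ 2) * Real.cos (2 * Real.pi * inner ℝ ξ x)) := by
    rw [← integral_const_mul]
    congr 1 with ξ
    ring
  rw [this]
  exact mul_nonneg (hw0 u hu) (hf.mul_exp (hε.trans hu.out.le) s hs x)

theorem add_const_mul {f g : V → ℝ} (hf : GaussianPositive f) (hg : GaussianPositive g)
    (hfm : Measurable f) (hgm : Measurable g) {A B : ℝ} (hfb : ∀ ξ, |f ξ| ≤ A)
    (hgb : ∀ ξ, |g ξ| ≤ B) {c : ℝ} (hc : 0 ≤ c) :
    GaussianPositive fun ξ => f ξ + c * g ξ := by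
  intro s hs x
  have hi := (integrable_exp_mul_cos hs x).bdd_mul (c := A) hfm.aestronglyMeasurable
    (.of_forall hfb)
  have hj := (integrable_exp_mul_cos hs x).bdd_mul (c := B) hgm.aestronglyMeasurable
    (.of_forall hgb)
  simp_rw [add_mul, mul_assoc c]
  rw [integral_add hi (hj.const_mul c), integral_const_mul]
  exact add_nonneg (hf s hs x) (mul_nonneg hc (hg s hs x))

/-- The exponential of a Laplace transform `h` of a finite measure on `(ε, ∞)`, evaluated at
`‖ξ‖²`, is Gaussian-positive, because `exp h = lim (1 + h / n) ^ n` and multiplication by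
`1 + h / n` preserves Gaussian-positivity. -/
theorem exp_laplace {ε : ℝ} (hε : 0 ≤ ε) {w : ℝ → ℝ} (hw : IntegrableOn w (Ioi ε))
    (hw0 : ∀ u ∈ Ioi ε, 0 ≤ w u) :
    GaussianPositive fun ξ : V => Real.exp (∫ u in Ioi ε, w u * Real.exp (-u * ‖ξ‖ ^ 2)) := by
  set h : V → ℝ := fun ξ => ∫ u in Ioi ε, w u * Real.exp (-u * ‖ξ‖ ^ 2)
  set H := ∫ u in Ioi ε, w u
  have hexp : ∀ u ∈ Ioi ε, ∀ ξ : V, Real.exp (-u * ‖ξ‖ ^ 2) ≤ 1 := fun u hu ξ => by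
    have : 0 < u := hε.trans_lt hu
    rw [Real.exp_le_one_iff]
    nlinarith [sq_nonneg ‖ξ‖]
  have hint (ξ : V) : IntegrableOn (fun u => w u * Real.exp (-u * ‖ξ‖ ^ 2)) (Ioi ε) :=
    hw.mul_bdd (c := 1) (by fun_prop) ((ae_restrict_mem measurableSet_Ioi).mono fun u hu => by
      rw [Real.norm_eq_abs, Real.abs_exp]; exact hexp u hu ξ)
  have h0 (ξ : V) : 0 ≤ h ξ := setIntegral_nonneg measurableSet_Ioi fun u hu =>
    mul_nonneg (hw0 u hu) (Real.exp_pos _).le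
  have hH (ξ : V) : h ξ ≤ H := setIntegral_mono_on (hint ξ) hw measurableSet_Ioi fun u hu =>
    mul_le_of_le_one_right (hw0 u hu) (hexp u hu ξ)
  have hc : Continuous h := by
    refine continuous_of_dominated (bound := fun u => |w u|) (fun ξ => (hint ξ).1) (fun ξ => ?_)
      hw.abs (.of_forall fun u => by fun_prop)
    filter_upwards [ae_restrict_mem measurableSet_Ioi] with u hu
    rw [norm_mul, Real.norm_eq_abs, Real.norm_eq_abs, Real.abs_exp]
    exact mul_le_of_le_one_right (abs_nonneg _) (hexp u hu ξ)
  have hbd (c : ℝ) (hc : 0 ≤ c) (k : ℕ) (ξ : V) : |(1 + c * h ξ) ^ k| ≤ (1 + c * H) ^ k := by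
    rw [abs_of_nonneg (pow_nonneg (by have := h0 ξ; positivity) _)]
    have := h0 ξ
    gcongr
    exact hH ξ
  have hpow (c : ℝ) (hc0 : 0 ≤ c) (k : ℕ) : GaussianPositive fun ξ : V => (1 + c * h ξ) ^ k := by
    induction k with
    | zero => simpa using one
    | succ k ih =>
      have hm : Measurable fun ξ : V => (1 + c * h ξ) ^ k := by fun_prop
      have h1 := ih.mul_laplace hm (hbd c hc0 k) hε hw hw0
      have := ih.add_const_mul h1 hm (hm.mul hc.measurable) (hbd c hc0 k)
        (B := (1 + c * H) ^ k * H) (fun ξ => by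
          rw [abs_mul, abs_of_nonneg (h0 ξ)]
          exact mul_le_mul (hbd c hc0 k ξ) (hH ξ) (h0 ξ) ((abs_nonneg _).trans (hbd c hc0 k ξ)))
        hc0
      convert this using 2 with ξ
      rw [pow_succ]; simp only [h]; ring
  refine of_tendsto (f := fun n ξ => (1 + (n : ℝ)⁻¹ * h ξ) ^ n) (C := Real.exp H)
    (fun n => hpow _ (by positivity) n) (fun n => by fun_prop) (fun n ξ => ?_) (fun ξ => ?_)
  · have := h0 ξ
    rw [abs_of_nonneg (by positivity)]
    rcases Nat.eq_zero_or_pos n with rfl | hn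
    · simpa using this.trans (hH ξ)
    calc (1 + (n : ℝ)⁻¹ * h ξ) ^ n ≤ (Real.exp ((n : ℝ)⁻¹ * h ξ)) ^ n := by
          gcongr
          linarith [Real.add_one_le_exp ((n : ℝ)⁻¹ * h ξ)]
      _ = Real.exp (h ξ) := by
          rw [← Real.exp_nat_mul]
          congr 1
          field_simp
      _ ≤ _ := Real.exp_le_exp.2 (hH ξ)
  · have := Real.tendsto_one_add_div_pow_exp (h ξ)
    refine this.congr fun n => ?_
    rw [div_eq_inv_mul]

end GaussianPositive
end Positivity

/-! ### Positivity of the stable multiplier -/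

theorem integrableOn_one_sub_exp_mul_rpow {α : ℝ} (hα₀ : 0 < α) (hα₁ : α < 1) :
    IntegrableOn (fun u : ℝ => (1 - Real.exp (-u)) * u ^ (-1 - α)) (Ioi 0) := by
  have hm : AEStronglyMeasurable (fun u : ℝ => (1 - Real.exp (-u)) * u ^ (-1 - α)) :=
    (by fun_prop : Measurable _).aestronglyMeasurable
  rw [← Ioc_union_Ioi_eq_Ioi (zero_le_one' ℝ)]
  refine IntegrableOn.union ?_ ?_
  · have h : IntegrableOn (fun u : ℝ => u ^ (-α)) (Ioc 0 1) := by
      rw [← intervalIntegrable_iff_integrableOn_Ioc_of_le zero_le_one]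
      exact intervalIntegral.intervalIntegrable_rpow' (by linarith)
    refine Integrable.mono' h hm.restrict ?_
    filter_upwards [ae_restrict_mem measurableSet_Ioc] with u hu
    have h1 : 0 ≤ 1 - Real.exp (-u) := by
      have := Real.exp_le_one_iff.2 (neg_nonpos.2 hu.1.le); linarith
    have h2 : 1 - Real.exp (-u) ≤ u := by linarith [Real.add_one_le_exp (-u)]
    have h3 := Real.rpow_nonneg hu.1.le (-1 - α)
    rw [Real.norm_eq_abs, abs_of_nonneg (mul_nonneg h1 h3)]
    calc _ ≤ u * u ^ (-1 - α) := by gcongr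
      _ = u ^ (-α) := by
        rw [mul_comm, ← Real.rpow_add_one hu.1.ne']; ring_nf
  · have h : IntegrableOn (fun u : ℝ => u ^ (-1 - α)) (Ioi 1) :=
      integrableOn_Ioi_rpow_of_lt (by linarith) one_pos
    refine Integrable.mono' h hm.restrict ?_
    filter_upwards [ae_restrict_mem measurableSet_Ioi] with u hu
    have hu0 : 0 < u := one_pos.trans hu
    have h1 : 0 ≤ 1 - Real.exp (-u) := by
      have := Real.exp_le_one_iff.2 (neg_nonpos.2 hu0.le); linarith
    have h3 := Real.rpow_nonneg hu0.le (-1 - α)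
    rw [Real.norm_eq_abs, abs_of_nonneg (mul_nonneg h1 h3)]
    exact mul_le_of_le_one_left h3 (by linarith [Real.exp_pos (-u)])

theorem integral_one_sub_exp_mul_rpow_pos {α : ℝ} (hα₀ : 0 < α) (hα₁ : α < 1) :
    0 < ∫ u in Ioi (0 : ℝ), (1 - Real.exp (-u)) * u ^ (-1 - α) := by
  have hpos : ∀ u ∈ Ioi (0 : ℝ), 0 < (1 - Real.exp (-u)) * u ^ (-1 - α) := fun u hu => by
    have hu : 0 < u := hu
    have : Real.exp (-u) < 1 := by simpa using Real.exp_lt_exp.2 (neg_neg_of_pos hu)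
    exact mul_pos (by linarith) (Real.rpow_pos_of_pos hu _)
  rw [setIntegral_pos_iff_support_of_nonneg_ae
    ((ae_restrict_mem measurableSet_Ioi).mono fun u hu => (hpos u hu).le)
    (integrableOn_one_sub_exp_mul_rpow hα₀ hα₁)]
  have : Ioi (0 : ℝ) ⊆ Function.support (fun u : ℝ => (1 - Real.exp (-u)) * u ^ (-1 - α)) ∩ Ioi 0 :=
    fun u hu => ⟨(hpos u hu).ne', hu⟩
  exact lt_of_lt_of_le (by simp) (measure_mono this)

/-- The function `l ↦ l ^ α` is, up to a constant, the Bernstein function with Lévy density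
`u ^ (-1 - α)`. -/
theorem integral_one_sub_exp_neg_mul_mul_rpow {α : ℝ} (hα₀ : 0 < α) (hα₁ : α < 1) {l : ℝ}
    (hl : 0 ≤ l) :
    IntegrableOn (fun u : ℝ => (1 - Real.exp (-u * l)) * u ^ (-1 - α)) (Ioi 0) ∧
    ∫ u in Ioi (0 : ℝ), (1 - Real.exp (-u * l)) * u ^ (-1 - α) =
      l ^ α * ∫ u in Ioi (0 : ℝ), (1 - Real.exp (-u)) * u ^ (-1 - α) := by
  rcases hl.eq_or_lt with rfl | hl
  · simp [Real.zero_rpow hα₀.ne']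
  have e : EqOn (fun u : ℝ => l ^ (1 + α) * ((1 - Real.exp (-(l * u))) * (l * u) ^ (-1 - α)))
      (fun u : ℝ => (1 - Real.exp (-u * l)) * u ^ (-1 - α)) (Ioi 0) := by
    intro u hu
    simp only
    rw [Real.mul_rpow hl.le (le_of_lt hu), show -u * l = -(l * u) by ring]
    have : l ^ (1 + α) * l ^ (-1 - α) = 1 := by
      rw [← Real.rpow_add hl]; simp
    linear_combination ((1 - Real.exp (-(l * u))) * u ^ (-1 - α)) * this
  have h1 := (integrableOn_Ioi_comp_mul_left_iff
    (fun u : ℝ => (1 - Real.exp (-u)) * u ^ (-1 - α)) 0 hl).2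
    (by simpa using integrableOn_one_sub_exp_mul_rpow hα₀ hα₁)
  refine ⟨IntegrableOn.congr_fun (h1.const_mul (l ^ (1 + α))) e measurableSet_Ioi, ?_⟩
  rw [← setIntegral_congr_fun measurableSet_Ioi e, integral_const_mul,
    integral_comp_mul_left_Ioi (fun u : ℝ => (1 - Real.exp (-u)) * u ^ (-1 - α)) 0 hl, mul_zero,
    smul_eq_mul, ← mul_assoc, Real.rpow_add hl, Real.rpow_one]
  congr 1
  field_simp

section Positivity
variable {V : Type*} [NormedAddCommGroup V] [InnerProductSpace ℝ V] [FiniteDimensional ℝ V]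
  [MeasurableSpace V] [BorelSpace V]

namespace GaussianPositive

theorem mul_const {f : V → ℝ} (hf : GaussianPositive f) {c : ℝ} (hc : 0 ≤ c) :
    GaussianPositive fun ξ => f ξ * c := by
  intro s hs x
  have : ∀ ξ, f ξ * c * (Real.exp (-s * ‖ξ‖ ^ 2) * Real.cos (2 * Real.pi * inner ℝ ξ x)) =
    c * (f ξ * (Real.exp (-s * ‖ξ‖ ^ 2) * Real.cos (2 * Real.pi * inner ℝ ξ x))) :=
    fun ξ => by ring
  simp_rw [this, integral_const_mul]
  exact mul_nonneg hc (hf s hs x)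

/-- The characteristic function of a rotationally symmetric `2α`-stable law is
Gaussian-positive: it is the limit, as the small jumps are restored, of the characteristic
functions of compound Poisson mixtures of Gaussians. -/
theorem exp_neg_rpow {α τ : ℝ} (hα₀ : 0 < α) (hα₁ : α < 1) (hτ : 0 ≤ τ) :
    GaussianPositive fun ξ : V => Real.exp (-(τ * ‖ξ‖ ^ (2 * α))) := by
  set K := ∫ u in Ioi (0 : ℝ), (1 - Real.exp (-u)) * u ^ (-1 - α) with hK
  have hK0 : 0 < K := integral_one_sub_exp_mul_rpow_pos hα₀ hα₁
  set c := τ / K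
  have hc : 0 ≤ c := by positivity
  let F : V → ℝ → ℝ := fun ξ u => c * ((1 - Real.exp (-u * ‖ξ‖ ^ 2)) * u ^ (-1 - α))
  have hF0 (ξ : V) : ∀ u ∈ Ioi (0 : ℝ), 0 ≤ F ξ u := fun u hu => by
    have hu : 0 < u := hu
    have : Real.exp (-u * ‖ξ‖ ^ 2) ≤ 1 := Real.exp_le_one_iff.2 (by
      nlinarith [sq_nonneg ‖ξ‖])
    exact mul_nonneg hc (mul_nonneg (by linarith) (Real.rpow_nonneg hu.le _))
  have hFi (ξ : V) : IntegrableOn (F ξ) (Ioi 0) :=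
    (integral_one_sub_exp_neg_mul_mul_rpow hα₀ hα₁ (sq_nonneg ‖ξ‖)).1.const_mul c
  have hFe (ξ : V) : ∫ u in Ioi 0, F ξ u = τ * ‖ξ‖ ^ (2 * α) := by
    simp only [F]
    rw [integral_const_mul,
      (integral_one_sub_exp_neg_mul_mul_rpow hα₀ hα₁ (sq_nonneg ‖ξ‖)).2, ← hK,
      Real.rpow_mul (norm_nonneg _), Real.rpow_two]
    simp only [c]
    field_simp
  -- Keeping only `u > ε n` makes the Lévy density `c u ^ (-1 - α)` integrable.
  let ε : ℕ → ℝ := fun n => 1 / ((n : ℝ) + 1)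
  have hε (n : ℕ) : 0 < ε n := Nat.one_div_pos_of_nat
  have hw (n : ℕ) : IntegrableOn (fun u : ℝ => c * u ^ (-1 - α)) (Ioi (ε n)) :=
    (integrableOn_Ioi_rpow_of_lt (by linarith) (hε n)).const_mul c
  have hw0 (n : ℕ) : ∀ u ∈ Ioi (ε n), 0 ≤ c * u ^ (-1 - α) := fun u hu =>
    mul_nonneg hc (Real.rpow_nonneg ((hε n).trans hu).le _)
  have hsub (n : ℕ) : Ioi (ε n) ⊆ Ioi 0 := Ioi_subset_Ioi (hε n).le
  have hsplit (n : ℕ) (ξ : V) : Real.exp (-∫ u in Ioi (ε n), F ξ u) =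
      Real.exp (∫ u in Ioi (ε n), c * u ^ (-1 - α) * Real.exp (-u * ‖ξ‖ ^ 2)) *
        Real.exp (-∫ u in Ioi (ε n), c * u ^ (-1 - α)) := by
    have hFn := (hFi ξ).mono_set (hsub n)
    rw [← Real.exp_add]
    congr 1
    have : ∀ u, c * u ^ (-1 - α) * Real.exp (-u * ‖ξ‖ ^ 2) = c * u ^ (-1 - α) - F ξ u :=
      fun u => by simp only [F]; ring
    simp_rw [this]
    rw [integral_sub (hw n) hFn]
    ring
  have hpos (n : ℕ) : GaussianPositive fun ξ : V => Real.exp (-∫ u in Ioi (ε n), F ξ u) := by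
    simp_rw [hsplit]
    exact (exp_laplace (hε n).le (hw n) (hw0 n)).mul_const (Real.exp_pos _).le
  refine of_tendsto (C := 1) hpos (fun n => ?_) (fun n ξ => ?_) (fun ξ => ?_)
  · have : StronglyMeasurable fun ξ : V => ∫ u in Ioi (ε n), F ξ u := by
      refine StronglyMeasurable.integral_prod_right (f := F) (Measurable.stronglyMeasurable ?_)
      simp only [F, Function.uncurry_def]
      fun_prop
    exact this.measurable.neg.exp
  · rw [Real.abs_exp, Real.exp_le_one_iff, neg_nonpos]
    exact setIntegral_nonneg measurableSet_Ioi fun u hu => hF0 ξ u (hsub n hu)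
  · refine (Real.continuous_exp.tendsto _).comp ?_
    rw [← hFe]
    have hU : ⋃ n, Ioi (ε n) = Ioi 0 := by
      refine subset_antisymm (iUnion_subset hsub) fun u hu => ?_
      obtain ⟨n, hn⟩ := exists_nat_one_div_lt (show (0 : ℝ) < u from hu)
      exact mem_iUnion.2 ⟨n, hn⟩
    have := tendsto_setIntegral_of_monotone (f := F ξ) (μ := volume) (s := fun n => Ioi (ε n))
      (fun n => measurableSet_Ioi)
      (fun n m hnm => Ioi_subset_Ioi (Nat.one_div_le_one_div hnm)) (by rw [hU]; exact hFi ξ)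
    rw [hU] at this
    exact this.neg

theorem integral_mul_cos_nonneg {f : V → ℝ} (hf : GaussianPositive f) (hi : Integrable f)
    (x : V) : 0 ≤ ∫ ξ, f ξ * Real.cos (2 * Real.pi * inner ℝ ξ x) := by
  let s : ℕ → ℝ := fun n => 1 / ((n : ℝ) + 1)
  have hs (n : ℕ) : 0 < s n := Nat.one_div_pos_of_nat
  refine ge_of_tendsto' (tendsto_integral_of_dominated_convergence (fun ξ => |f ξ|) (fun n => ?_)
    hi.abs (fun n => .of_forall fun ξ => ?_) (.of_forall fun ξ => ?_))
    (fun n => hf (s n) (hs n) x)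
  · exact hi.1.mul (by fun_prop)
  · rw [norm_mul, norm_mul, Real.norm_eq_abs, Real.norm_eq_abs, Real.norm_eq_abs, Real.abs_exp]
    have h1 : Real.exp (-s n * ‖ξ‖ ^ 2) ≤ 1 := Real.exp_le_one_iff.2 (by
      nlinarith [sq_nonneg ‖ξ‖, hs n])
    exact mul_le_of_le_one_right (abs_nonneg _)
      (mul_le_one₀ h1 (abs_nonneg _) (Real.abs_cos_le_one _))
  · have h0 : Tendsto s atTop (𝓝 0) := tendsto_one_div_add_atTop_nhds_zero_nat
    have h1 : Tendsto (fun n => Real.exp (-s n * ‖ξ‖ ^ 2)) atTop (𝓝 1) := by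
      have := (Real.continuous_exp.tendsto _).comp (h0.neg.mul_const (‖ξ‖ ^ 2))
      simpa [Function.comp_def] using this
    simpa using (h1.mul_const (Real.cos (2 * Real.pi * inner ℝ ξ x))).const_mul (f ξ)

end GaussianPositive
end Positivity

/-! ### The symbol of the operator -/

/-- The characteristic exponent `D_o r² + D_f r^{2α}`, as a function of the modulus `r` of the
angular frequency. -/
noncomputable def ffpeExponent (Do Df α r : ℝ) : ℝ := Do * r ^ 2 + Df * r ^ (2 * α)

/-- The Fourier symbol of `b · ∇ + D_o Δ - D_f (-Δ)^α`, as a function of the ordinary frequency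
`ξ`; the angular frequency is `2πξ`. -/
noncomputable def ffpeSymbol {d : ℕ} (b : EuclideanSpace ℝ (Fin d)) (Do Df α : ℝ)
    (ξ : EuclideanSpace ℝ (Fin d)) : ℂ :=
  (2 * Real.pi * inner ℝ ξ b : ℝ) * Complex.I - (ffpeExponent Do Df α (2 * Real.pi * ‖ξ‖) : ℝ)

/-- The characteristic function `ξ ↦ E exp (2πi⟨X_t, ξ⟩)` of the solution at time `t`. -/
noncomputable def ffpeFourier {d : ℕ} (b x₀ : EuclideanSpace ℝ (Fin d)) (Do Df α t : ℝ)
    (ξ : EuclideanSpace ℝ (Fin d)) : ℂ :=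
  Complex.exp ((2 * Real.pi * inner ℝ ξ x₀ : ℝ) * Complex.I + t * ffpeSymbol b Do Df α ξ)

section Exponent
variable {Do Df α : ℝ}

theorem ffpeExponent_nonneg (hDo : 0 ≤ Do) (hDf : 0 ≤ Df) {r : ℝ} (hr : 0 ≤ r) :
    0 ≤ ffpeExponent Do Df α r := by
  unfold ffpeExponent; positivity

theorem ffpeExponent_le (hDo : 0 ≤ Do) (hDf : 0 ≤ Df) (hα₀ : 0 < α) (hα₁ : α < 1) {r : ℝ}
    (hr : 0 ≤ r) : ffpeExponent Do Df α r ≤ (Do + Df) * (1 + r ^ 2) := by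
  have h : r ^ (2 * α) ≤ 1 + r ^ 2 := by
    rcases le_total r 1 with h1 | h1
    · have := Real.rpow_le_one hr h1 (by positivity : 0 ≤ 2 * α)
      nlinarith [sq_nonneg r]
    · have := Real.rpow_le_rpow_of_exponent_le h1 (by linarith : 2 * α ≤ 2)
      rw [Real.rpow_two] at this
      linarith
  unfold ffpeExponent
  nlinarith [mul_le_mul_of_nonneg_left h hDf]

theorem continuous_ffpeExponent (hα₀ : 0 < α) : Continuous (ffpeExponent Do Df α) := by
  unfold ffpeExponent
  have : Continuous fun r : ℝ => r ^ (2 * α) := Real.continuous_rpow_const (by positivity)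
  fun_prop

/-- The exponent dominates a power: `r²` if `D_o > 0`, and otherwise `r^{2α}`. -/
theorem exists_mul_rpow_le_ffpeExponent (hDo : 0 ≤ Do) (hDf : 0 ≤ Df) (hD : 0 < Do + Df)
    (hα₀ : 0 < α) : ∃ c β : ℝ, 0 < c ∧ 0 < β ∧ ∀ r, 0 ≤ r → c * r ^ β ≤ ffpeExponent Do Df α r := by
  rcases hDo.eq_or_lt with rfl | h
  · refine ⟨Df, 2 * α, by linarith, by positivity, fun r hr => ?_⟩
    simp [ffpeExponent]
  · refine ⟨Do, 2, h, two_pos, fun r hr => ?_⟩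
    unfold ffpeExponent
    have : 0 ≤ Df * r ^ (2 * α) := by positivity
    rw [Real.rpow_two]; linarith

theorem integrable_exp_neg_ffpeExponent {d : ℕ} [NeZero d] (hDo : 0 ≤ Do) (hDf : 0 ≤ Df)
    (hD : 0 < Do + Df) (hα₀ : 0 < α) {t : ℝ} (ht : 0 < t) :
    Integrable fun ξ : EuclideanSpace ℝ (Fin d) =>
      Real.exp (-(t * ffpeExponent Do Df α (2 * Real.pi * ‖ξ‖))) := by
  obtain ⟨c, β, hc, hβ, hle⟩ := exists_mul_rpow_le_ffpeExponent hDo hDf hD hα₀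
  rw [integrable_fun_norm_addHaar (volume : Measure (EuclideanSpace ℝ (Fin d)))
    (f := fun r => Real.exp (-(t * ffpeExponent Do Df α (2 * Real.pi * r)))),
    finrank_euclideanSpace_fin]
  have h := integrableOn_rpow_mul_exp_neg_mul_rpow (s := (d - 1 : ℕ)) (p := β)
    (b := t * c * (2 * Real.pi) ^ β)
    (by have : (0 : ℝ) ≤ (d - 1 : ℕ) := Nat.cast_nonneg _; linarith) hβ (by positivity)
  have hcont := continuous_ffpeExponent (Do := Do) (Df := Df) hα₀
  refine Integrable.mono' h (by fun_prop) ?_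
  filter_upwards [ae_restrict_mem measurableSet_Ioi] with r hr
  have hr : 0 < r := hr
  rw [smul_eq_mul, norm_mul, Real.norm_eq_abs, Real.norm_eq_abs, Real.abs_exp,
    abs_of_nonneg (by positivity), Real.rpow_natCast]
  gcongr
  have := hle (2 * Real.pi * r) (by positivity)
  rw [Real.mul_rpow (by positivity) hr.le] at this
  nlinarith [mul_le_mul_of_nonneg_left this ht.le]

end Exponent

section Symbol
variable {d : ℕ} (b x₀ : EuclideanSpace ℝ (Fin d)) {Do Df α : ℝ}

theorem continuous_ffpeSymbol (hα₀ : 0 < α) : Continuous (ffpeSymbol b Do Df α) := by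
  have hcont := continuous_ffpeExponent (Do := Do) (Df := Df) hα₀
  unfold ffpeSymbol
  fun_prop

theorem continuous_ffpeFourier (hα₀ : 0 < α) (t : ℝ) :
    Continuous (ffpeFourier b x₀ Do Df α t) := by
  have hcont := continuous_ffpeSymbol b (Do := Do) (Df := Df) hα₀
  unfold ffpeFourier
  fun_prop

theorem norm_ffpeFourier (t : ℝ) (ξ : EuclideanSpace ℝ (Fin d)) :
    ‖ffpeFourier b x₀ Do Df α t ξ‖ =
      Real.exp (-(t * ffpeExponent Do Df α (2 * Real.pi * ‖ξ‖))) := by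
  rw [ffpeFourier, Complex.norm_exp, ffpeSymbol]
  simp only [Complex.add_re, Complex.re_ofReal_mul, Complex.sub_re, Complex.I_re,
    Complex.ofReal_re]
  ring_nf

theorem norm_ffpeFourier_le_one (hDo : 0 ≤ Do) (hDf : 0 ≤ Df) {t : ℝ} (ht : 0 ≤ t)
    (ξ : EuclideanSpace ℝ (Fin d)) : ‖ffpeFourier b x₀ Do Df α t ξ‖ ≤ 1 := by
  rw [norm_ffpeFourier, Real.exp_le_one_iff, neg_nonpos]
  exact mul_nonneg ht (ffpeExponent_nonneg hDo hDf (by positivity))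

theorem integrable_ffpeFourier [NeZero d] (hDo : 0 ≤ Do) (hDf : 0 ≤ Df) (hD : 0 < Do + Df)
    (hα₀ : 0 < α) {t : ℝ} (ht : 0 < t) : Integrable (ffpeFourier b x₀ Do Df α t) := by
  refine (integrable_exp_neg_ffpeExponent hDo hDf hD hα₀ ht).mono'
    (continuous_ffpeFourier b x₀ hα₀ t).aestronglyMeasurable (.of_forall fun ξ => ?_)
  rw [norm_ffpeFourier]

theorem ffpeFourier_zero_time (ξ : EuclideanSpace ℝ (Fin d)) :
    ffpeFourier b x₀ Do Df α 0 ξ = Complex.exp ((2 * Real.pi * inner ℝ ξ x₀ : ℝ) * Complex.I) := by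
  simp [ffpeFourier]

theorem ffpeFourier_zero_freq (hα₀ : 0 < α) (t : ℝ) : ffpeFourier b x₀ Do Df α t 0 = 1 := by
  have : (2 * α) ≠ 0 := by positivity
  simp [ffpeFourier, ffpeSymbol, ffpeExponent, Real.zero_rpow this]

theorem hasDerivAt_ffpeFourier (t : ℝ) (ξ : EuclideanSpace ℝ (Fin d)) :
    HasDerivAt (fun s => ffpeFourier b x₀ Do Df α s ξ)
      (ffpeFourier b x₀ Do Df α t ξ * ffpeSymbol b Do Df α ξ) t := by
  unfold ffpeFourier
  have h1 : HasDerivAt (fun s : ℝ => (s : ℂ)) 1 t := Complex.ofRealCLM.hasDerivAt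
  have h2 := ((h1.mul_const (ffpeSymbol b Do Df α ξ)).const_add
    ((2 * Real.pi * inner ℝ ξ x₀ : ℝ) * Complex.I)).cexp
  rwa [one_mul] at h2

theorem norm_ffpeSymbol_le (hDo : 0 ≤ Do) (hDf : 0 ≤ Df) (hα₀ : 0 < α) (hα₁ : α < 1)
    (ξ : EuclideanSpace ℝ (Fin d)) :
    ‖ffpeSymbol b Do Df α ξ‖ ≤ (‖b‖ + Do + Df) * (1 + (2 * Real.pi * ‖ξ‖) ^ 2) := by
  have hr : 0 ≤ 2 * Real.pi * ‖ξ‖ := by positivity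
  have h1 : ‖((2 * Real.pi * inner ℝ ξ b : ℝ) : ℂ) * Complex.I‖ ≤
      ‖b‖ * (1 + (2 * Real.pi * ‖ξ‖) ^ 2) := by
    rw [norm_mul, Complex.norm_I, mul_one, Complex.norm_real, Real.norm_eq_abs, abs_mul,
      abs_of_pos Real.two_pi_pos]
    have h2 := abs_real_inner_le_norm ξ b
    have h3 : 2 * Real.pi * ‖ξ‖ ≤ 1 + (2 * Real.pi * ‖ξ‖) ^ 2 := by nlinarith
    calc _ ≤ 2 * Real.pi * (‖ξ‖ * ‖b‖) := by gcongr
      _ = ‖b‖ * (2 * Real.pi * ‖ξ‖) := by ring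
      _ ≤ _ := by gcongr
  have h2 : ‖((ffpeExponent Do Df α (2 * Real.pi * ‖ξ‖) : ℝ) : ℂ)‖ ≤
      (Do + Df) * (1 + (2 * Real.pi * ‖ξ‖) ^ 2) := by
    rw [Complex.norm_real, Real.norm_eq_abs, abs_of_nonneg (ffpeExponent_nonneg hDo hDf hr)]
    exact ffpeExponent_le hDo hDf hα₀ hα₁ hr
  calc _ ≤ _ := norm_sub_le _ _
    _ ≤ _ := add_le_add h1 h2
    _ = _ := by ring

theorem integrable_ffpeSymbol_mul (hDo : 0 ≤ Do) (hDf : 0 ≤ Df) (hα₀ : 0 < α) (hα₁ : α < 1)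
    (Φ : 𝓢(EuclideanSpace ℝ (Fin d), ℂ)) :
    Integrable fun ξ => ffpeSymbol b Do Df α ξ * Φ ξ := by
  have h1 := Φ.integrable_pow_mul volume 2
  have h2 := Φ.integrable (μ := volume) |>.norm
  refine ((h2.add (h1.const_mul ((2 * Real.pi) ^ 2))).const_mul (‖b‖ + Do + Df)).mono'
    ((continuous_ffpeSymbol b hα₀).aestronglyMeasurable.mul Φ.continuous.aestronglyMeasurable)
    (.of_forall fun ξ => ?_)
  rw [norm_mul]
  refine (mul_le_mul_of_nonneg_right (norm_ffpeSymbol_le b hDo hDf hα₀ hα₁ ξ)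
    (norm_nonneg _)).trans_eq ?_
  simp only [Pi.add_apply]
  ring

theorem integrable_fourierInv_integrand {f : EuclideanSpace ℝ (Fin d) → ℂ} (hf : Integrable f)
    (x : EuclideanSpace ℝ (Fin d)) :
    Integrable fun ξ => Complex.exp (↑(2 * Real.pi * inner ℝ ξ x) * Complex.I) • f ξ := by
  refine hf.bdd_mul (c := 1) (by fun_prop) (.of_forall fun ξ => ?_)
  rw [Complex.norm_exp_ofReal_mul_I]

/-- The adjoint operator acts on Schwartz functions as the Fourier multiplier with symbol
`ffpeSymbol`. -/
theorem ffpeAdjoint_eq_fourierInv (hα₀ : 0 < α) (hα₁ : α < 1)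
    (φ : 𝓢(EuclideanSpace ℝ (Fin d), ℂ)) (x : EuclideanSpace ℝ (Fin d)) :
    ffpeAdjoint b Do Df α φ x = 𝓕⁻ (fun ξ => ffpeSymbol b Do Df α ξ * 𝓕 φ ξ) x := by
  have hb : (fun ξ : EuclideanSpace ℝ (Fin d) => inner ℝ ξ b).HasTemperateGrowth := by fun_prop
  have hn : (fun ξ : EuclideanSpace ℝ (Fin d) => ‖ξ‖ ^ 2).HasTemperateGrowth := by fun_prop
  have h1 : fderiv ℝ φ x b = 𝓕⁻ (fun ξ : EuclideanSpace ℝ (Fin d) =>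
      ((2 * Real.pi * inner ℝ ξ b : ℝ) * Complex.I : ℂ) * 𝓕 φ ξ) x := by
    rw [← SchwartzMap.lineDerivOp_apply_eq_fderiv, SchwartzMap.lineDeriv_eq_fourierMultiplierCLM,
      SchwartzMap.fourierMultiplierCLM_apply, ← FourierTransform.fourierInv_smul,
      SchwartzMap.fourierInv_coe]
    refine congrArg (fun f : EuclideanSpace ℝ (Fin d) → ℂ => 𝓕⁻ f x) (funext fun ξ => ?_)
    simp [hb]
    ring
  have h2 : Laplacian.laplacian (φ : EuclideanSpace ℝ (Fin d) → ℂ) x =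
      𝓕⁻ (fun ξ : EuclideanSpace ℝ (Fin d) =>
        (-((2 * Real.pi * ‖ξ‖) ^ 2 : ℝ) : ℂ) * 𝓕 φ ξ) x := by
    rw [← SchwartzMap.laplacian_apply, SchwartzMap.laplacian_eq_fourierMultiplierCLM,
      SchwartzMap.fourierMultiplierCLM_apply, ← FourierTransform.fourierInv_smul,
      SchwartzMap.fourierInv_coe]
    refine congrArg (fun f : EuclideanSpace ℝ (Fin d) → ℂ => 𝓕⁻ f x) (funext fun ξ => ?_)
    have : SchwartzMap.smulLeftCLM ℂ (fun ξ : EuclideanSpace ℝ (Fin d) => ‖ξ‖ ^ 2) (𝓕 φ) ξ =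
      (‖ξ‖ ^ 2) • 𝓕 φ ξ := SchwartzMap.smulLeftCLM_apply_apply hn _ _
    simp only [smul_apply]
    erw [this]
    simp
    ring
  -- Each of the three terms of the operator is integrable: specialize the symbol to one term.
  have i1 := integrable_ffpeSymbol_mul b le_rfl le_rfl hα₀ hα₁ (𝓕 φ)
  have i2 := integrable_ffpeSymbol_mul (0 : EuclideanSpace ℝ (Fin d)) zero_le_one le_rfl hα₀ hα₁
    (𝓕 φ)
  have i3 := integrable_ffpeSymbol_mul (0 : EuclideanSpace ℝ (Fin d)) le_rfl zero_le_one hα₀ hα₁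
    (𝓕 φ)
  simp only [ffpeSymbol, ffpeExponent, zero_mul, one_mul, add_zero, zero_add, inner_zero_right,
    mul_zero, Complex.ofReal_zero, sub_zero, zero_sub] at i1 i2 i3
  have j1 := integrable_fourierInv_integrand i1 x
  have j2 := integrable_fourierInv_integrand i2 x
  have j3 := integrable_fourierInv_integrand i3 x
  rw [ffpeAdjoint, h1, h2, fracLaplacian]
  simp only [Real.fourierInv_eq']
  have j3' : Integrable fun ξ : EuclideanSpace ℝ (Fin d) => (Df : ℂ) *
      Complex.exp (↑(2 * Real.pi * inner ℝ ξ x) * Complex.I) •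
        ((((2 * Real.pi * ‖ξ‖) ^ (2 * α) : ℝ) : ℂ) *
          𝓕 (φ : EuclideanSpace ℝ (Fin d) → ℂ) ξ) := by
    refine (j3.const_mul (-(Df : ℂ))).congr (.of_forall fun ξ => ?_)
    simp only [smul_eq_mul, SchwartzMap.fourier_coe]
    ring
  have k := integral_sub (j1.add (j2.const_mul (Do : ℂ))) j3'
  simp only [Pi.add_apply] at k
  rw [← integral_const_mul, ← integral_const_mul, ← integral_add j1 (j2.const_mul _), ← k]
  congr 1
  ext ξ
  simp only [ffpeSymbol, ffpeExponent, smul_eq_mul, SchwartzMap.fourier_coe]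
  push_cast
  ring

end Symbol

/-! ### Fourier transforms of integrable functions -/

section Fourier
variable {V : Type*} [NormedAddCommGroup V] [InnerProductSpace ℝ V] [FiniteDimensional ℝ V]
  [MeasurableSpace V] [BorelSpace V]

theorem continuous_fourier {f : V → ℂ} (hf : Integrable f) : Continuous (𝓕 f) :=
  VectorFourier.fourierIntegral_continuous Real.continuous_fourierChar
    (L := innerₗ V) continuous_inner hf

/-- Self-adjointness of the inverse Fourier transform on integrable functions. -/
theorem integral_mul_fourierInv_eq {f g : V → ℂ} (hf : Integrable f) (hg : Integrable g) :
    ∫ x, f x * 𝓕⁻ g x = ∫ ξ, 𝓕⁻ f ξ * g ξ := by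
  have h := VectorFourier.integral_fourierIntegral_smul_eq_flip (μ := volume) (ν := volume)
    (L := -innerₗ V) Real.continuous_fourierChar
    (continuous_inner (𝕜 := ℝ) (E := V)).neg hf hg
  have e : (-innerₗ V).flip = -innerₗ V := by
    ext x y; simp [real_inner_comm]
  rw [e] at h
  exact h.symm

/-- A nonnegative Fourier transform of an integrable function that is continuous at the origin is
integrable: the integrals of its products with wider and wider Gaussians converge to the value at
the origin, and Fatou's lemma applies. -/
theorem integrable_of_nonneg_of_eq_fourier {f : V → ℂ} (hf : Integrable f)
    (hc : ContinuousAt f 0) {q : V → ℝ} (hq : ∀ x, 0 ≤ q x) (hqf : ∀ x, (q x : ℂ) = 𝓕 f x) :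
    Integrable q := by
  have hqc : Continuous q := by
    have h : q = fun x => (𝓕 f x).re := funext fun x => by rw [← hqf, Complex.ofReal_re]
    rw [h]
    exact Complex.continuous_re.comp (continuous_fourier hf)
  let g : ℕ → V → ℝ := fun n x => Real.exp (-((n : ℝ) + 1)⁻¹ * ‖x‖ ^ 2)
  have hpos (n : ℕ) : 0 < ((n : ℝ) + 1)⁻¹ := by positivity
  have hqb (x : V) : ‖q x‖ ≤ ∫ ξ, ‖f ξ‖ := by
    rw [← Complex.norm_real, hqf]
    exact VectorFourier.norm_fourierIntegral_le_integral_norm _ _ _ _ _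
  have hgi (n : ℕ) : Integrable fun x => q x * g n x :=
    (integrable_exp_neg_mul_norm_sq (hpos n)).bdd_mul hqc.aestronglyMeasurable (.of_forall hqb)
  have hlim : Tendsto (fun n => ∫ x, q x * g n x) atTop (𝓝 (f 0).re) := by
    have h1 := (Real.tendsto_integral_gaussian_smul' hf hc).comp
      (tendsto_natCast_atTop_atTop.atTop_add (tendsto_const_nhds (x := (1 : ℝ))))
    refine ((Complex.continuous_re.tendsto _).comp h1).congr fun n => ?_
    simp only [Function.comp_apply]
    rw [← Complex.ofReal_re (∫ x, q x * g n x), ← integral_complex_ofReal]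
    congr 1
    have hG : Integrable fun x : V => Complex.exp (-((((n : ℝ) + 1)⁻¹ : ℝ) : ℂ) * ‖x‖ ^ 2) := by
      have := (integrable_exp_neg_mul_norm_sq (V := V) (hpos n)).ofReal (𝕜 := ℂ)
      refine this.congr (.of_forall fun x => ?_)
      simp
    have h2 := VectorFourier.integral_fourierIntegral_smul_eq_flip (μ := volume) (ν := volume)
      (L := innerₗ V) Real.continuous_fourierChar continuous_inner hG hf
    rw [flip_innerₗ] at h2
    have h3 : ∀ w : V, VectorFourier.fourierIntegral Real.fourierChar volume (innerₗ V)
        (fun x : V => Complex.exp (-((((n : ℝ) + 1)⁻¹ : ℝ) : ℂ) * ‖x‖ ^ 2)) w = _ :=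
      fun w => fourier_gaussian_innerProductSpace (by rw [Complex.ofReal_re]; exact hpos n) w
    simp only [h3] at h2
    convert h2 using 1
    · congr 1 with w
      congr 2
      · congr 1
        push_cast
        rw [div_inv_eq_mul]
      · congr 1
        push_cast
        rw [div_inv_eq_mul, zero_sub, norm_neg]
        ring
    · congr 1 with x
      rw [Complex.ofReal_mul, hqf, smul_eq_mul, mul_comm]
      simp only [g]
      push_cast
      rfl
  refine ⟨hqc.aestronglyMeasurable, ?_⟩
  rw [hasFiniteIntegral_iff_ofReal (.of_forall hq)]
  have hpt (x : V) : Tendsto (fun n => ENNReal.ofReal (q x * g n x)) atTop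
      (𝓝 (ENNReal.ofReal (q x))) := by
    refine ENNReal.tendsto_ofReal ?_
    have h0 : Tendsto (fun n : ℕ => ((n : ℝ) + 1)⁻¹) atTop (𝓝 0) := by
      simpa using tendsto_one_div_add_atTop_nhds_zero_nat (𝕜 := ℝ)
    have h1 := (Real.continuous_exp.tendsto _).comp (h0.neg.mul_const (‖x‖ ^ 2))
    simpa [Function.comp_def, g] using h1.const_mul (q x)
  calc ∫⁻ x, ENNReal.ofReal (q x)
      = ∫⁻ x, liminf (fun n => ENNReal.ofReal (q x * g n x)) atTop :=
        lintegral_congr fun x => (hpt x).liminf_eq.symm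
    _ ≤ liminf (fun n => ∫⁻ x, ENNReal.ofReal (q x * g n x)) atTop :=
        lintegral_liminf_le fun n => by fun_prop
    _ = liminf (fun n => ENNReal.ofReal (∫ x, q x * g n x)) atTop := by
        congr 1 with n
        rw [ofReal_integral_eq_lintegral_ofReal (hgi n)
          (.of_forall fun x => mul_nonneg (hq x) (Real.exp_pos _).le)]
    _ = ENNReal.ofReal (f 0).re := (ENNReal.tendsto_ofReal hlim).liminf_eq
    _ < ⊤ := ENNReal.ofReal_lt_top

end Fourier

/-! ### Existence of a fundamental solution -/

/-- The fundamental solution, written as a cosine integral over frequency space. -/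
noncomputable def ffpeDensity {d : ℕ} (b x₀ : EuclideanSpace ℝ (Fin d)) (Do Df α : ℝ)
    (x : EuclideanSpace ℝ (Fin d)) (t : ℝ) : ℝ :=
  ∫ ξ : EuclideanSpace ℝ (Fin d), Real.exp (-(t * ffpeExponent Do Df α (2 * Real.pi * ‖ξ‖))) *
    Real.cos (2 * Real.pi * inner ℝ ξ (x - x₀ - t • b))

section Existence
variable {d : ℕ} [NeZero d] (b x₀ : EuclideanSpace ℝ (Fin d)) {Do Df α : ℝ}

/-- The density is the Fourier transform of `ffpeFourier`: the sine part is odd and integrates to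
zero, and `exp (2πi⟨ξ, x₀ + t b⟩)` accounts for the translation. -/
theorem ofReal_ffpeDensity (hDo : 0 ≤ Do) (hDf : 0 ≤ Df) (hD : 0 < Do + Df)
    (hα₀ : 0 < α) {t : ℝ} (ht : 0 < t) (x : EuclideanSpace ℝ (Fin d)) :
    (ffpeDensity b x₀ Do Df α x t : ℂ) = 𝓕 (ffpeFourier b x₀ Do Df α t) x := by
  set z := x - x₀ - t • b with hz
  set w : EuclideanSpace ℝ (Fin d) → ℝ := fun ξ =>
    Real.exp (-(t * ffpeExponent Do Df α (2 * Real.pi * ‖ξ‖))) with hw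
  have hwi : Integrable w := integrable_exp_neg_ffpeExponent hDo hDf hD hα₀ ht
  have hcos : Integrable fun ξ => w ξ * Real.cos (2 * Real.pi * inner ℝ ξ z) :=
    hwi.mul_bdd (c := 1) (by fun_prop) (.of_forall fun _ => Real.abs_cos_le_one _)
  have hsin : Integrable fun ξ => w ξ * Real.sin (2 * Real.pi * inner ℝ ξ z) :=
    hwi.mul_bdd (c := 1) (by fun_prop) (.of_forall fun _ => Real.abs_sin_le_one _)
  have hodd : ∫ ξ, w ξ * Real.sin (2 * Real.pi * inner ℝ ξ z) = 0 := by
    have h := integral_neg_eq_self (fun ξ => w ξ * Real.sin (2 * Real.pi * inner ℝ ξ z)) volume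
    simp only [hw, norm_neg, inner_neg_left, mul_neg, Real.sin_neg, integral_neg] at h ⊢
    linarith
  have e : ∀ ξ, Complex.exp (↑(-2 * Real.pi * inner ℝ ξ x) * Complex.I) •
      ffpeFourier b x₀ Do Df α t ξ =
      ((w ξ * Real.cos (2 * Real.pi * inner ℝ ξ z) : ℝ) : ℂ) -
        ((w ξ * Real.sin (2 * Real.pi * inner ℝ ξ z) : ℝ) : ℂ) * Complex.I := by
    intro ξ
    have h1 : ((Real.cos (2 * Real.pi * inner ℝ ξ z) : ℝ) : ℂ) -
        ((Real.sin (2 * Real.pi * inner ℝ ξ z) : ℝ) : ℂ) * Complex.I =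
        Complex.exp (((-(2 * Real.pi * inner ℝ ξ z) : ℝ) : ℂ) * Complex.I) := by
      rw [Complex.exp_mul_I, ← Complex.ofReal_cos, ← Complex.ofReal_sin, Real.cos_neg,
        Real.sin_neg]
      push_cast; ring
    rw [Complex.ofReal_mul (w ξ), Complex.ofReal_mul (w ξ), mul_assoc ((w ξ : ℝ) : ℂ), ← mul_sub,
      h1, hw]
    rw [Complex.ofReal_exp, ← Complex.exp_add, smul_eq_mul, ffpeFourier, ffpeSymbol,
      ← Complex.exp_add, hz, inner_sub_right, inner_sub_right, inner_smul_right]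
    congr 1
    push_cast
    ring
  rw [Real.fourier_eq']
  simp_rw [e]
  rw [integral_sub hcos.ofReal (hsin.ofReal.mul_const _), integral_mul_const,
    integral_complex_ofReal, integral_complex_ofReal, hodd, ffpeDensity,
    Complex.ofReal_zero, zero_mul, sub_zero]

theorem ffpeDensity_nonneg (hDo : 0 ≤ Do) (hDf : 0 ≤ Df) (hD : 0 < Do + Df)
    (hα₀ : 0 < α) (hα₁ : α < 1) {t : ℝ} (ht : 0 < t) (x : EuclideanSpace ℝ (Fin d)) :
    0 ≤ ffpeDensity b x₀ Do Df α x t := by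
  refine GaussianPositive.integral_mul_cos_nonneg ?_
    (integrable_exp_neg_ffpeExponent hDo hDf hD hα₀ ht) _
  have h1 := GaussianPositive.exp_neg_rpow (V := EuclideanSpace ℝ (Fin d)) hα₀ hα₁
    (by positivity : 0 ≤ t * Df * (2 * Real.pi) ^ (2 * α))
  have h2 := h1.mul_exp (by positivity : 0 ≤ t * Do * (2 * Real.pi) ^ 2)
  convert h2 using 2 with ξ
  rw [← Real.exp_add, ffpeExponent, Real.mul_rpow Real.two_pi_pos.le (norm_nonneg _)]
  congr 1
  ring

theorem continuous_ffpeDensity (hDo : 0 ≤ Do) (hDf : 0 ≤ Df) (hD : 0 < Do + Df)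
    (hα₀ : 0 < α) {t : ℝ} (ht : 0 < t) : Continuous fun x => ffpeDensity b x₀ Do Df α x t := by
  have h : (fun x => ffpeDensity b x₀ Do Df α x t) =
      fun x => (𝓕 (ffpeFourier b x₀ Do Df α t) x).re := funext fun x => by
    rw [← ofReal_ffpeDensity b x₀ hDo hDf hD hα₀ ht, Complex.ofReal_re]
  rw [h]
  exact Complex.continuous_re.comp
    (continuous_fourier (integrable_ffpeFourier b x₀ hDo hDf hD hα₀ ht))

theorem integrable_ffpeDensity (hDo : 0 ≤ Do) (hDf : 0 ≤ Df) (hD : 0 < Do + Df)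
    (hα₀ : 0 < α) (hα₁ : α < 1) {t : ℝ} (ht : 0 < t) :
    Integrable fun x => ffpeDensity b x₀ Do Df α x t :=
  integrable_of_nonneg_of_eq_fourier (integrable_ffpeFourier b x₀ hDo hDf hD hα₀ ht)
    (continuous_ffpeFourier b x₀ hα₀ t).continuousAt
    (ffpeDensity_nonneg b x₀ hDo hDf hD hα₀ hα₁ ht)
    (ofReal_ffpeDensity b x₀ hDo hDf hD hα₀ ht)

theorem fourierInv_ffpeDensity (hDo : 0 ≤ Do) (hDf : 0 ≤ Df) (hD : 0 < Do + Df)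
    (hα₀ : 0 < α) (hα₁ : α < 1) {t : ℝ} (ht : 0 < t) :
    𝓕⁻ (fun x => (ffpeDensity b x₀ Do Df α x t : ℂ)) = ffpeFourier b x₀ Do Df α t := by
  have h : (fun x => (ffpeDensity b x₀ Do Df α x t : ℂ)) = 𝓕 (ffpeFourier b x₀ Do Df α t) :=
    funext (ofReal_ffpeDensity b x₀ hDo hDf hD hα₀ ht)
  rw [h]
  refine (continuous_ffpeFourier b x₀ hα₀ t).fourierInv_fourier_eq
    (integrable_ffpeFourier b x₀ hDo hDf hD hα₀ ht) ?_
  rw [← h]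
  exact (integrable_ffpeDensity b x₀ hDo hDf hD hα₀ hα₁ ht).ofReal

/-- On the Fourier side, testing against `φ` reads `∫ ffpeFourier t * 𝓕 φ`, which can be
differentiated in `t` under the integral sign. -/
theorem isFundamentalSolution_ffpeDensity (hDo : 0 ≤ Do) (hDf : 0 ≤ Df) (hD : 0 < Do + Df)
    (hα₀ : 0 < α) (hα₁ : α < 1) :
    IsFundamentalSolution b x₀ Do Df α (ffpeDensity b x₀ Do Df α) := by
  have hpair {t : ℝ} (ht : 0 < t) {h : EuclideanSpace ℝ (Fin d) → ℂ} (hh : Integrable h) :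
      ∫ x, (ffpeDensity b x₀ Do Df α x t : ℂ) * 𝓕⁻ h x =
        ∫ ξ, ffpeFourier b x₀ Do Df α t ξ * h ξ := by
    have := integral_mul_fourierInv_eq (f := fun x => (ffpeDensity b x₀ Do Df α x t : ℂ))
      (integrable_ffpeDensity b x₀ hDo hDf hD hα₀ hα₁ ht).ofReal hh
    rwa [fourierInv_ffpeDensity b x₀ hDo hDf hD hα₀ hα₁ ht] at this
  have hφ (φ : 𝓢(EuclideanSpace ℝ (Fin d), ℂ)) (x) :
      φ x = 𝓕⁻ (⇑(𝓕 φ : 𝓢(EuclideanSpace ℝ (Fin d), ℂ))) x := by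
    rw [← SchwartzMap.fourierInv_coe, FourierTransform.fourierInv_fourier_eq]
  have htest (φ : 𝓢(EuclideanSpace ℝ (Fin d), ℂ)) {t : ℝ} (ht : 0 < t) :
      ∫ x, (ffpeDensity b x₀ Do Df α x t : ℂ) * φ x =
        ∫ ξ, ffpeFourier b x₀ Do Df α t ξ * 𝓕 φ ξ := by
    simp_rw [hφ φ]
    exact hpair ht (𝓕 φ).integrable
  have hm (φ : 𝓢(EuclideanSpace ℝ (Fin d), ℂ)) (t : ℝ) :
      AEStronglyMeasurable fun ξ => ffpeFourier b x₀ Do Df α t ξ * 𝓕 φ ξ :=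
    (continuous_ffpeFourier b x₀ hα₀ t).aestronglyMeasurable.mul
      (𝓕 φ).continuous.aestronglyMeasurable
  have hle (φ : 𝓢(EuclideanSpace ℝ (Fin d), ℂ)) {t : ℝ} (ht : 0 ≤ t) (ξ) :
      ‖ffpeFourier b x₀ Do Df α t ξ * 𝓕 φ ξ‖ ≤ ‖𝓕 φ ξ‖ := by
    rw [norm_mul]
    exact mul_le_of_le_one_left (norm_nonneg _) (norm_ffpeFourier_le_one b x₀ hDo hDf ht ξ)
  refine ⟨fun t ht => continuous_ffpeDensity b x₀ hDo hDf hD hα₀ ht,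
    fun t ht => ffpeDensity_nonneg b x₀ hDo hDf hD hα₀ hα₁ ht,
    fun t ht => integrable_ffpeDensity b x₀ hDo hDf hD hα₀ hα₁ ht, fun t ht => ?_,
    fun φ t ht => ?_, fun φ => ?_⟩
  · have h := congrFun (fourierInv_ffpeDensity b x₀ hDo hDf hD hα₀ hα₁ ht) 0
    rw [ffpeFourier_zero_freq b x₀ hα₀, Real.fourierInv_eq'] at h
    simp only [inner_zero_right, mul_zero, Complex.ofReal_zero, zero_mul, Complex.exp_zero,
      one_smul, integral_complex_ofReal] at h
    exact_mod_cast h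
  · have hR : ∫ x, (ffpeDensity b x₀ Do Df α x t : ℂ) * ffpeAdjoint b Do Df α φ x =
        ∫ ξ, (ffpeFourier b x₀ Do Df α t ξ * ffpeSymbol b Do Df α ξ) * 𝓕 φ ξ := by
      simp_rw [ffpeAdjoint_eq_fourierInv b hα₀ hα₁ φ, mul_assoc]
      exact hpair ht (integrable_ffpeSymbol_mul b hDo hDf hα₀ hα₁ (𝓕 φ))
    rw [hR]
    have hd := (hasDerivAt_integral_of_dominated_loc_of_deriv_le (μ := volume) (x₀ := t)
      (F := fun s ξ => ffpeFourier b x₀ Do Df α s ξ * 𝓕 φ ξ)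
      (F' := fun s ξ => (ffpeFourier b x₀ Do Df α s ξ * ffpeSymbol b Do Df α ξ) * 𝓕 φ ξ)
      (s := Ioi 0) (bound := fun ξ => ‖ffpeSymbol b Do Df α ξ * 𝓕 φ ξ‖) (Ioi_mem_nhds ht)
      (.of_forall fun s => hm φ s)
      ((𝓕 φ).integrable.norm.mono' (hm φ t) (.of_forall (hle φ ht.le)))
      (((continuous_ffpeFourier b x₀ hα₀ t).mul
        (continuous_ffpeSymbol b hα₀)).aestronglyMeasurable.mul
        (𝓕 φ).continuous.aestronglyMeasurable)
      (.of_forall fun ξ s hs => ?_)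
      (integrable_ffpeSymbol_mul b hDo hDf hα₀ hα₁ (𝓕 φ)).norm
      (.of_forall fun ξ s hs => (hasDerivAt_ffpeFourier b x₀ s ξ).mul_const _)).2
    · refine hd.congr_of_eventuallyEq ?_
      filter_upwards [Ioi_mem_nhds ht] with s hs using htest φ hs
    · rw [mul_assoc, norm_mul]
      exact mul_le_of_le_one_left (norm_nonneg _)
        (norm_ffpeFourier_le_one b x₀ hDo hDf (le_of_lt hs) ξ)
  · have h0 : φ x₀ = ∫ ξ, ffpeFourier b x₀ Do Df α 0 ξ * 𝓕 φ ξ := by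
      simp_rw [ffpeFourier_zero_time]
      rw [hφ φ, Real.fourierInv_eq']
      rfl
    rw [h0]
    have : Tendsto (fun t => ∫ ξ, ffpeFourier b x₀ Do Df α t ξ * 𝓕 φ ξ) (𝓝[>] 0)
        (𝓝 (∫ ξ, ffpeFourier b x₀ Do Df α 0 ξ * 𝓕 φ ξ)) := by
      refine tendsto_integral_filter_of_dominated_convergence (fun ξ => ‖𝓕 φ ξ‖)
        (.of_forall fun t => hm φ t) ?_ (𝓕 φ).integrable.norm (.of_forall fun ξ => ?_)
      · filter_upwards [self_mem_nhdsWithin] with t ht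
        exact .of_forall (hle φ (le_of_lt ht))
      · exact ((hasDerivAt_ffpeFourier b x₀ 0 ξ).continuousAt.tendsto.mono_left
          nhdsWithin_le_nhds).mul_const _
    refine this.congr' ?_
    filter_upwards [self_mem_nhdsWithin] with t ht using (htest φ ht).symm

end Existence

/-! ### Uniqueness of the fundamental solution -/

/-- If `F n → q` and `(F n)' → m * q` pointwise and boundedly on `(0, ∞)`, then `q` solves
`q' = m * q`, with initial value the limit of the initial values of the `F n`. -/
theorem eq_exp_mul_of_tendsto_hasDerivAt {F F' : ℕ → ℝ → ℂ} {q : ℝ → ℂ} {a : ℕ → ℂ} {a₀ m : ℂ}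
    {A B : ℝ} (hder : ∀ n s, 0 < s → HasDerivAt (F n) (F' n s) s)
    (hinit : ∀ n, Tendsto (F n) (𝓝[>] 0) (𝓝 (a n))) (ha : Tendsto a atTop (𝓝 a₀))
    (hF : ∀ s, 0 < s → Tendsto (fun n => F n s) atTop (𝓝 (q s)))
    (hF' : ∀ s, 0 < s → Tendsto (fun n => F' n s) atTop (𝓝 (m * q s)))
    (hA : ∀ n s, 0 < s → ‖F n s‖ ≤ A) (hB : ∀ n s, 0 < s → ‖F' n s‖ ≤ B) {t : ℝ} (ht : 0 < t) :
    q t = Complex.exp (t * m) * a₀ := by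
  -- The integrating factor turns the claim into `∫₀ᵗ (H n)' → 0` for `H n s = exp (-s m) F n s`.
  let H : ℕ → ℝ → ℂ := fun n s => Complex.exp (-(s * m)) * F n s
  let R : ℕ → ℝ → ℂ := fun n s => Complex.exp (-(s * m)) * (F' n s - m * F n s)
  have hexp (s : ℝ) : HasDerivAt (fun s : ℝ => Complex.exp (-(s * m)))
      (Complex.exp (-(s * m)) * (-m)) s := by
    have h1 : HasDerivAt (fun s : ℝ => (s : ℂ)) 1 s := Complex.ofRealCLM.hasDerivAt
    have h2 := (h1.mul_const m).neg.cexp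
    simpa using h2
  have hH (n : ℕ) (s : ℝ) (hs : 0 < s) : HasDerivAt (H n) (R n s) s := by
    refine ((hexp s).mul (hder n s hs)).congr_deriv ?_
    simp only [R]
    ring
  have hbound (n : ℕ) (s : ℝ) (hs : s ∈ Ioc 0 t) :
      ‖R n s‖ ≤ Real.exp (t * ‖m‖) * (B + ‖m‖ * A) := by
    have hE : ‖Complex.exp (-(s * m))‖ ≤ Real.exp (t * ‖m‖) := by
      refine (Complex.norm_exp_le_exp_norm _).trans (Real.exp_le_exp.2 ?_)
      rw [norm_neg, norm_mul, Complex.norm_real, Real.norm_eq_abs, abs_of_pos hs.1]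
      exact mul_le_mul_of_nonneg_right hs.2 (norm_nonneg _)
    simp only [R]
    rw [norm_mul]
    have h2 : ‖F' n s - m * F n s‖ ≤ B + ‖m‖ * A := by
      refine (norm_sub_le _ _).trans (add_le_add (hB n s hs.1) ?_)
      rw [norm_mul]
      exact mul_le_mul_of_nonneg_left (hA n s hs.1) (norm_nonneg _)
    exact mul_le_mul hE h2 (norm_nonneg _) (Real.exp_pos _).le
  have hmeas (n : ℕ) : AEStronglyMeasurable (R n) (volume.restrict (Ioc 0 t)) := by
    refine (aestronglyMeasurable_deriv (H n) _).congr ?_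
    filter_upwards [ae_restrict_mem measurableSet_Ioc] with s hs using (hH n s hs.1).deriv
  have hint (n : ℕ) : IntervalIntegrable (R n) volume 0 t := by
    rw [intervalIntegrable_iff_integrableOn_Ioc_of_le ht.le]
    refine (integrable_const (Real.exp (t * ‖m‖) * (B + ‖m‖ * A))).mono' (hmeas n) ?_
    filter_upwards [ae_restrict_mem measurableSet_Ioc] with s hs using hbound n s hs
  have hftc (n : ℕ) : ∫ s in (0 : ℝ)..t, R n s = H n t - a n := by
    refine intervalIntegral.integral_eq_sub_of_hasDerivAt_of_tendsto ht
      (fun s hs => hH n s hs.1) (hint n) ?_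
      ((hH n t ht).continuousAt.tendsto.mono_left nhdsWithin_le_nhds)
    have := ((hexp 0).continuousAt.tendsto.mono_left nhdsWithin_le_nhds).mul (hinit n)
    simpa using this
  have hlim : Tendsto (fun n => ∫ s in (0 : ℝ)..t, R n s) atTop
      (𝓝 (∫ s in (0 : ℝ)..t, (0 : ℂ))) := by
    refine intervalIntegral.tendsto_integral_filter_of_dominated_convergence
      (fun _ => Real.exp (t * ‖m‖) * (B + ‖m‖ * A)) (.of_forall fun n => ?_)
      (.of_forall fun n => .of_forall fun s hs => ?_) intervalIntegrable_const
      (.of_forall fun s hs => ?_)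
    · rw [uIoc_of_le ht.le]; exact hmeas n
    · rw [uIoc_of_le ht.le] at hs; exact hbound n s hs
    · rw [uIoc_of_le ht.le] at hs
      have := ((hF' s hs.1).sub ((hF s hs.1).const_mul m)).const_mul (Complex.exp (-(s * m)))
      simpa using this
  simp only [hftc, intervalIntegral.integral_zero] at hlim
  have hlim2 : Tendsto (fun n => H n t - a n) atTop
      (𝓝 (Complex.exp (-(t * m)) * q t - a₀)) := ((hF t ht).const_mul _).sub ha
  have h0 := tendsto_nhds_unique hlim hlim2
  have h1 : Complex.exp (t * m) * Complex.exp (-(t * m)) = 1 := by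
    rw [← Complex.exp_add, add_neg_cancel, Complex.exp_zero]
  linear_combination (-Complex.exp (t * m)) * h0 - q t * h1

section Approx
variable {V : Type*} [NormedAddCommGroup V] [InnerProductSpace ℝ V] [FiniteDimensional ℝ V]
  [MeasurableSpace V] [BorelSpace V]

/-- An approximate identity at `ξ₀` made of Schwartz functions. -/
theorem exists_schwartz_approx_identity (ξ₀ : V) :
    ∃ ψ : ℕ → 𝓢(V, ℂ), (∀ n, ∫ ξ, ‖ψ n ξ‖ = 1) ∧ (∀ n ξ, ψ n ξ ≠ 0 → ‖ξ‖ ≤ ‖ξ₀‖ + 1) ∧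
      ∀ g : V → ℂ, Continuous g → Tendsto (fun n => ∫ ξ, ψ n ξ * g ξ) atTop (𝓝 (g ξ₀)) := by
  let r : ℕ → ℝ := fun n => 1 / ((n : ℝ) + 1)
  have hr (n : ℕ) : 0 < r n := Nat.one_div_pos_of_nat
  have hr1 (n : ℕ) : r n ≤ 1 := by
    have := Nat.one_div_le_one_div (α := ℝ) (Nat.zero_le n)
    simpa [r] using this
  let φ : ℕ → ContDiffBump (0 : V) := fun n => ⟨r n / 2, r n, half_pos (hr n), half_lt_self (hr n)⟩
  let k : ℕ → V → ℝ := fun n ξ => (φ n).normed volume (ξ₀ - ξ)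
  have hk0 (n : ℕ) (ξ : V) : 0 ≤ k n ξ := (φ n).nonneg_normed _
  have hsupp (n : ℕ) : HasCompactSupport fun ξ => (k n ξ : ℂ) :=
    (((φ n).hasCompactSupport_normed (μ := volume)).comp_homeomorph
      (Homeomorph.subLeft ξ₀)).comp_left (g := ((↑) : ℝ → ℂ)) Complex.ofReal_zero
  have hdiff (n : ℕ) : ContDiff ℝ (⊤ : ℕ∞) fun ξ => (k n ξ : ℂ) :=
    Complex.ofRealCLM.contDiff.comp ((φ n).contDiff_normed.comp (contDiff_const.sub contDiff_id))
  refine ⟨fun n => (hsupp n).toSchwartzMap (hdiff n), fun n => ?_, fun n ξ hξ => ?_,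
    fun g hg => ?_⟩
  · have : ∀ ξ, ‖(hsupp n).toSchwartzMap (hdiff n) ξ‖ = k n ξ := fun ξ => by
      simp [abs_of_nonneg (hk0 n ξ)]
    simp_rw [this]
    simp only [k]
    rw [integral_sub_left_eq_self (fun ξ => (φ n).normed volume ξ) volume ξ₀,
      (φ n).integral_normed]
  · have h1 : (φ n).normed volume (ξ₀ - ξ) ≠ 0 := by
      intro h
      exact hξ (by simp [k, h])
    have h2 : ξ₀ - ξ ∈ Metric.ball (0 : V) (φ n).rOut := by
      rw [← (φ n).support_normed_eq (μ := volume)]; exact h1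
    have h3 : ‖ξ₀ - ξ‖ < r n := by simpa using h2
    have h4 := norm_sub_norm_le ξ ξ₀
    rw [norm_sub_rev] at h4
    linarith [hr1 n]
  · have h := ContDiffBump.convolution_tendsto_right_of_continuous (μ := (volume : Measure V))
      (φ := φ) (l := atTop) (tendsto_one_div_add_atTop_nhds_zero_nat (𝕜 := ℝ)) hg ξ₀
    refine h.congr fun n => ?_
    rw [convolution_eq_swap]
    congr 1 with ξ

end Approx

section Uniqueness
variable {d : ℕ} {b x₀ : EuclideanSpace ℝ (Fin d)} {Do Df α : ℝ}
  {p : EuclideanSpace ℝ (Fin d) → ℝ → ℝ}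

/-- A function dominated by `C ‖ψ‖`, with `ψ` of unit `L¹` norm, has an inverse Fourier transform
bounded by `C`. -/
theorem norm_fourierInv_le_of_bound {f : EuclideanSpace ℝ (Fin d) → ℂ}
    {ψ : EuclideanSpace ℝ (Fin d) → ℂ} (hψ : Integrable ψ) (h1 : ∫ ξ, ‖ψ ξ‖ = 1) {C : ℝ}
    (h : ∀ ξ, ‖f ξ‖ ≤ C * ‖ψ ξ‖) (x : EuclideanSpace ℝ (Fin d)) : ‖𝓕⁻ f x‖ ≤ C := by
  rw [Real.fourierInv_eq']
  calc _ ≤ ∫ ξ, C * ‖ψ ξ‖ := norm_integral_le_of_norm_le (hψ.norm.const_mul C)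
        (.of_forall fun ξ => by
          rw [norm_smul, Complex.norm_exp_ofReal_mul_I, one_mul]; exact h ξ)
    _ = C := by rw [integral_const_mul, h1, mul_one]

/-- The characteristic function of any fundamental solution is `ffpeFourier`. Testing against the
inverse Fourier transforms of an approximate identity at `ξ` turns the weak equation into the
ordinary differential equation `q' = ffpeSymbol ξ * q`. -/
theorem IsFundamentalSolution.fourierInv_eq (hp : IsFundamentalSolution b x₀ Do Df α p)
    (hDo : 0 ≤ Do) (hDf : 0 ≤ Df) (hα₀ : 0 < α) (hα₁ : α < 1) {t : ℝ} (ht : 0 < t)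
    (ξ₀ : EuclideanSpace ℝ (Fin d)) :
    𝓕⁻ (fun x => (p x t : ℂ)) ξ₀ = ffpeFourier b x₀ Do Df α t ξ₀ := by
  obtain ⟨ψ, hψ1, hψs, hψt⟩ := exists_schwartz_approx_identity ξ₀
  let E := EuclideanSpace ℝ (Fin d)
  let φ : ℕ → 𝓢(E, ℂ) := fun n => 𝓕⁻ (ψ n)
  let e : E → ℂ := fun x => Complex.exp (↑(2 * Real.pi * inner ℝ ξ₀ x) * Complex.I)
  have he (x : E) : ‖e x‖ = 1 := Complex.norm_exp_ofReal_mul_I _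
  have hφ (n : ℕ) (x : E) : φ n x = 𝓕⁻ (⇑(ψ n)) x := by
    rw [← SchwartzMap.fourierInv_coe]
  have hL (n : ℕ) (x : E) : ffpeAdjoint b Do Df α (φ n) x =
      𝓕⁻ (fun ξ => ffpeSymbol b Do Df α ξ * ψ n ξ) x := by
    rw [ffpeAdjoint_eq_fourierInv b hα₀ hα₁, FourierTransform.fourier_fourierInv_eq]
  have hφb (n : ℕ) (x : E) : ‖φ n x‖ ≤ 1 := by
    rw [hφ]
    exact norm_fourierInv_le_of_bound (ψ n).integrable (hψ1 n) (fun ξ => by rw [one_mul]) x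
  set B := (‖b‖ + Do + Df) * (1 + (2 * Real.pi * (‖ξ₀‖ + 1)) ^ 2)
  have hLb (n : ℕ) (x : E) : ‖ffpeAdjoint b Do Df α (φ n) x‖ ≤ B := by
    rw [hL]
    refine norm_fourierInv_le_of_bound (ψ n).integrable (hψ1 n) (fun ξ => ?_) x
    rw [norm_mul]
    by_cases h0 : ψ n ξ = 0
    · simp [h0]
    · refine mul_le_mul_of_nonneg_right
        ((norm_ffpeSymbol_le b hDo hDf hα₀ hα₁ ξ).trans ?_) (norm_nonneg _)
      have := hψs n ξ h0
      simp only [B]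
      gcongr
  have hφt (x : E) : Tendsto (fun n => φ n x) atTop (𝓝 (e x)) := by
    refine (hψt (fun ξ => Complex.exp (↑(2 * Real.pi * inner ℝ ξ x) * Complex.I))
      (by fun_prop)).congr fun n => ?_
    rw [hφ, Real.fourierInv_eq']
    congr 1 with ξ
    rw [smul_eq_mul, mul_comm]
  have hLt (x : E) : Tendsto (fun n => ffpeAdjoint b Do Df α (φ n) x) atTop
      (𝓝 (ffpeSymbol b Do Df α ξ₀ * e x)) := by
    have hc := continuous_ffpeSymbol b (Do := Do) (Df := Df) hα₀
    refine (hψt (fun ξ => ffpeSymbol b Do Df α ξ *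
      Complex.exp (↑(2 * Real.pi * inner ℝ ξ x) * Complex.I)) (by fun_prop)).congr fun n => ?_
    rw [hL, Real.fourierInv_eq']
    congr 1 with ξ
    rw [smul_eq_mul]; ring
  have hLm (n : ℕ) : Continuous fun x => ffpeAdjoint b Do Df α (φ n) x := by
    have h : (fun x => ffpeAdjoint b Do Df α (φ n) x) =
        𝓕⁻ (fun ξ => ffpeSymbol b Do Df α ξ * ψ n ξ) := funext (hL n)
    rw [h, Real.fourierInv_eq_fourier_comp_neg]
    exact continuous_fourier (integrable_ffpeSymbol_mul b hDo hDf hα₀ hα₁ (ψ n)).comp_neg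
  have hpm (s : ℝ) (hs : 0 < s) : AEStronglyMeasurable fun x => (p x s : ℂ) :=
    (Complex.continuous_ofReal.comp (hp.continuous s hs)).aestronglyMeasurable
  have hpi (s : ℝ) (hs : 0 < s) (C : ℝ) : Integrable fun x => p x s * C :=
    (hp.integrable s hs).mul_const C
  have hnorm (s : ℝ) (hs : 0 < s) {g : E → ℂ} {C : ℝ} (hg : ∀ x, ‖g x‖ ≤ C) (x : E) :
      ‖(p x s : ℂ) * g x‖ ≤ p x s * C := by
    rw [norm_mul, Complex.norm_real, Real.norm_eq_abs, abs_of_nonneg (hp.nonneg s hs x)]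
    exact mul_le_mul_of_nonneg_left (hg x) (hp.nonneg s hs x)
  have hbd (s : ℝ) (hs : 0 < s) {g : E → ℂ} {C : ℝ} (hg : ∀ x, ‖g x‖ ≤ C) :
      ‖∫ x, (p x s : ℂ) * g x‖ ≤ C := by
    refine (norm_integral_le_of_norm_le (hpi s hs C) (.of_forall (hnorm s hs hg))).trans_eq ?_
    rw [integral_mul_const, hp.mass s hs, one_mul]
  have hlim (s : ℝ) (hs : 0 < s) {g : ℕ → E → ℂ} {g₀ : E → ℂ} {C : ℝ}
      (hg : ∀ n x, ‖g n x‖ ≤ C) (hc : ∀ n, Continuous (g n))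
      (h : ∀ x, Tendsto (fun n => g n x) atTop (𝓝 (g₀ x))) :
      Tendsto (fun n => ∫ x, (p x s : ℂ) * g n x) atTop (𝓝 (∫ x, (p x s : ℂ) * g₀ x)) :=
    tendsto_integral_of_dominated_convergence (fun x => p x s * C)
      (fun n => (hpm s hs).mul (hc n).aestronglyMeasurable) (hpi s hs C)
      (fun n => .of_forall (hnorm s hs (hg n))) (.of_forall fun x => (h x).const_mul _)
  have key := eq_exp_mul_of_tendsto_hasDerivAt (t := t)
    (F := fun n s => ∫ x, (p x s : ℂ) * φ n x)
    (F' := fun n s => ∫ x, (p x s : ℂ) * ffpeAdjoint b Do Df α (φ n) x)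
    (q := fun s => ∫ x, (p x s : ℂ) * e x) (m := ffpeSymbol b Do Df α ξ₀) (a₀ := e x₀)
    (fun n s hs => hp.equation (φ n) s hs) (fun n => hp.initial (φ n)) (hφt x₀)
    (fun s hs => hlim s hs hφb (fun n => (φ n).continuous) hφt)
    (fun s hs => by
      have := hlim s hs hLb hLm hLt
      simp_rw [mul_left_comm _ (ffpeSymbol b Do Df α ξ₀), integral_const_mul] at this
      exact this)
    (fun n s hs => hbd s hs (hφb n)) (fun n s hs => hbd s hs (hLb n)) ht
  rw [Real.fourierInv_eq', ffpeFourier, add_comm, Complex.exp_add, ← key]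
  congr 1 with x
  rw [smul_eq_mul, mul_comm, real_inner_comm]

theorem IsFundamentalSolution.eq_ffpeDensity [NeZero d]
    (hp : IsFundamentalSolution b x₀ Do Df α p) (hDo : 0 ≤ Do) (hDf : 0 ≤ Df) (hD : 0 < Do + Df)
    (hα₀ : 0 < α) (hα₁ : α < 1) {t : ℝ} (ht : 0 < t) (x : EuclideanSpace ℝ (Fin d)) :
    p x t = ffpeDensity b x₀ Do Df α x t := by
  have hinv : 𝓕⁻ (fun x => (p x t : ℂ)) = ffpeFourier b x₀ Do Df α t :=
    funext (hp.fourierInv_eq hDo hDf hα₀ hα₁ ht)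
  have hi := integrable_ffpeFourier b x₀ hDo hDf hD hα₀ ht
  have hF : Integrable (𝓕 fun x => (p x t : ℂ)) := by
    have h : (𝓕 fun x => (p x t : ℂ)) = fun ξ => ffpeFourier b x₀ Do Df α t (-ξ) := by
      ext ξ
      rw [← hinv, Real.fourierInv_eq_fourier_neg, neg_neg]
    rw [h]
    exact hi.comp_neg
  have h := (Complex.continuous_ofReal.comp (hp.continuous t ht)).fourier_fourierInv_eq
    (hp.integrable t ht).ofReal hF
  have h2 := congrFun h x
  simp only [Function.comp_def] at h2
  rw [hinv, ← ofReal_ffpeDensity b x₀ hDo hDf hD hα₀ ht] at h2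
  exact_mod_cast h2.symm

end Uniqueness

/-! ### The density in polar coordinates and the Bessel formulas -/

section Radial
variable {d : ℕ} [NeZero d] (b x₀ : EuclideanSpace ℝ (Fin d)) {Do Df α : ℝ}

/-- The density in polar coordinates, with `r` the modulus of the angular frequency. -/
theorem ffpeDensity_eq_integral_sphereTransform (hDo : 0 ≤ Do) (hDf : 0 ≤ Df) (hD : 0 < Do + Df)
    (hα₀ : 0 < α) {t : ℝ} (ht : 0 < t) (x : EuclideanSpace ℝ (Fin d)) :
    IntegrableOn (fun r : ℝ => (r / (2 * Real.pi)) ^ (d - 1) *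
      sphereTransform d (‖x - x₀ - t • b‖ * r) *
        Real.exp (-(Do * r ^ 2 + Df * r ^ (2 * α)) * t)) (Ioi 0) ∧
    ffpeDensity b x₀ Do Df α x t = 1 / (2 * Real.pi) *
      ∫ r in Ioi (0 : ℝ), (r / (2 * Real.pi)) ^ (d - 1) *
        sphereTransform d (‖x - x₀ - t • b‖ * r) *
          Real.exp (-(Do * r ^ 2 + Df * r ^ (2 * α)) * t) := by
  have hpi := Real.two_pi_pos
  obtain ⟨h1, h2⟩ := integral_radial_mul_cos
    (g := fun r => Real.exp (-(t * ffpeExponent Do Df α (2 * Real.pi * r))))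
    (integrable_exp_neg_ffpeExponent hDo hDf hD hα₀ ht) (x - x₀ - t • b)
  set f : ℝ → ℝ := fun r => (r / (2 * Real.pi)) ^ (d - 1) *
      sphereTransform d (‖x - x₀ - t • b‖ * r) *
        Real.exp (-(Do * r ^ 2 + Df * r ^ (2 * α)) * t)
  have e : ∀ r : ℝ, r ^ (d - 1) * (Real.exp (-(t * ffpeExponent Do Df α (2 * Real.pi * r))) *
      sphereTransform d (2 * Real.pi * r * ‖x - x₀ - t • b‖)) = f (2 * Real.pi * r) := by
    intro r
    simp only [f, ffpeExponent]
    rw [mul_div_cancel_left₀ _ hpi.ne', mul_comm ‖x - x₀ - t • b‖]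
    ring_nf
  simp only [e] at h1 h2
  constructor
  · simpa using (integrableOn_Ioi_comp_mul_left_iff f 0 hpi).1 h1
  · rw [ffpeDensity, h2, integral_comp_mul_left_Ioi f 0 hpi, mul_zero, smul_eq_mul, one_div]

end Radial

/-- The radial integrand written with the Bessel function of order `d / 2 - 1`. -/
theorem rpow_mul_besselJ_eq {d : ℕ} (hd : 1 ≤ d) {y r : ℝ} (hy : 0 < y) (hr : 0 < r) :
    (r / (2 * Real.pi)) ^ ((d : ℝ) / 2) * besselJ (((d : ℝ) - 2) / 2) (y * r) =
      y ^ (((d : ℝ) - 2) / 2) * (1 / (2 * Real.pi)) *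
        ((r / (2 * Real.pi)) ^ (d - 1) * sphereTransform d (y * r)) := by
  have hpi := Real.pi_pos
  have hs : 0 < r / (2 * Real.pi) := by positivity
  have h1 : y * r / 2 = y * (Real.pi * (r / (2 * Real.pi))) := by field_simp
  rw [besselJ_eq_sphereTransform, h1, Real.mul_rpow hy.le (by positivity),
    Real.mul_rpow hpi.le hs.le]
  have h2 : (r / (2 * Real.pi)) ^ (d - 1) =
      (r / (2 * Real.pi)) ^ ((d : ℝ) / 2) * (r / (2 * Real.pi)) ^ (((d : ℝ) - 2) / 2) := by
    rw [← Real.rpow_add hs, ← Real.rpow_natCast, Nat.cast_sub hd]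
    congr 1; push_cast; ring
  have h3 : Real.pi ^ ((d : ℝ) / 2) = Real.pi ^ (((d : ℝ) - 2) / 2) * Real.pi := by
    rw [← Real.rpow_add_one hpi.ne']
    congr 1; ring
  rw [h2, h3]
  have : Real.pi ^ (((d : ℝ) - 2) / 2) ≠ 0 := (Real.rpow_pos_of_pos hpi _).ne'
  field_simp

theorem sphereTransform_zero_eq_sphereArea {d : ℕ} (hd : 1 ≤ d) :
    sphereTransform d 0 = sphereArea (d - 1) := by
  rw [sphereTransform_zero, sphereArea, Nat.cast_sub hd]
  simp

theorem mainTheorem2 (d : ℕ) (hd : 1 ≤ d) (b x₀ : EuclideanSpace ℝ (Fin d)) (Do Df α : ℝ)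
    (hDo : 0 ≤ Do) (hDf : 0 ≤ Df) (hD : 0 < Do + Df) (hα₀ : 0 < α) (hα₁ : α < 1) :
    (∃ p : EuclideanSpace ℝ (Fin d) → ℝ → ℝ, IsFundamentalSolution b x₀ Do Df α p) ∧
    ∀ p : EuclideanSpace ℝ (Fin d) → ℝ → ℝ, IsFundamentalSolution b x₀ Do Df α p →
      ∀ (x : EuclideanSpace ℝ (Fin d)) (t y : ℝ), 0 < t → y = ‖x - x₀ - t • b‖ →
        (y ≠ 0 →
          IntegrableOn (fun r : ℝ => (r / (2 * Real.pi)) ^ ((d : ℝ) / 2) *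
            besselJ (((d : ℝ) - 2) / 2) (y * r) *
              Real.exp (-(Do * r ^ 2 + Df * r ^ (2 * α)) * t)) (Set.Ioi 0) ∧
          p x t = 1 / y ^ (((d : ℝ) - 2) / 2) *
            ∫ r in Set.Ioi (0 : ℝ), (r / (2 * Real.pi)) ^ ((d : ℝ) / 2) *
              besselJ (((d : ℝ) - 2) / 2) (y * r) *
                Real.exp (-(Do * r ^ 2 + Df * r ^ (2 * α)) * t)) ∧
        (d = 1 →
          IntegrableOn (fun r : ℝ => Real.cos (y * r) *
            Real.exp (-(Do * r ^ 2 + Df * r ^ (2 * α)) * t)) (Set.Ioi 0) ∧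
          p x t = 1 / Real.pi * ∫ r in Set.Ioi (0 : ℝ), Real.cos (y * r) *
            Real.exp (-(Do * r ^ 2 + Df * r ^ (2 * α)) * t)) ∧
        (y = 0 →
          IntegrableOn (fun r : ℝ => (r / (2 * Real.pi)) ^ (d - 1) *
            Real.exp (-(Do * r ^ 2 + Df * r ^ (2 * α)) * t)) (Set.Ioi 0) ∧
          p x t = sphereArea (d - 1) / (2 * Real.pi) *
            ∫ r in Set.Ioi (0 : ℝ), (r / (2 * Real.pi)) ^ (d - 1) *
              Real.exp (-(Do * r ^ 2 + Df * r ^ (2 * α)) * t)) := by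
  have : NeZero d := ⟨by omega⟩
  refine ⟨⟨_, isFundamentalSolution_ffpeDensity b x₀ hDo hDf hD hα₀ hα₁⟩, ?_⟩
  rintro p hp x t y ht hy
  obtain ⟨h1, h2⟩ := ffpeDensity_eq_integral_sphereTransform b x₀ hDo hDf hD hα₀ ht x
  rw [← hp.eq_ffpeDensity hDo hDf hD hα₀ hα₁ ht x, ← hy] at h2
  rw [← hy] at h1
  have hpi := Real.pi_pos
  refine ⟨fun hy0 => ?_, fun hd1 => ?_, fun hy0 => ?_⟩
  · have hypos : 0 < y := lt_of_le_of_ne (hy ▸ norm_nonneg _) hy0.symm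
    have hpow : y ^ (((d : ℝ) - 2) / 2) ≠ 0 := (Real.rpow_pos_of_pos hypos _).ne'
    have e : EqOn (fun r : ℝ => y ^ (((d : ℝ) - 2) / 2) * (1 / (2 * Real.pi)) *
        ((r / (2 * Real.pi)) ^ (d - 1) * sphereTransform d (y * r) *
          Real.exp (-(Do * r ^ 2 + Df * r ^ (2 * α)) * t)))
        (fun r : ℝ => (r / (2 * Real.pi)) ^ ((d : ℝ) / 2) *
            besselJ (((d : ℝ) - 2) / 2) (y * r) *
              Real.exp (-(Do * r ^ 2 + Df * r ^ (2 * α)) * t)) (Ioi 0) := by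
      intro r hr
      simp only
      rw [rpow_mul_besselJ_eq hd hypos hr]
      ring
    refine ⟨IntegrableOn.congr_fun (h1.const_mul _) e measurableSet_Ioi, ?_⟩
    rw [← setIntegral_congr_fun measurableSet_Ioi e, integral_const_mul, h2]
    have h (I : ℝ) : 1 / (2 * Real.pi) * I = 1 / y ^ (((d : ℝ) - 2) / 2) *
        (y ^ (((d : ℝ) - 2) / 2) * (1 / (2 * Real.pi)) * I) := by field_simp
    exact h _
  · subst hd1
    have e : ∀ r : ℝ, (r / (2 * Real.pi)) ^ (1 - 1) * sphereTransform 1 (y * r) *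
        Real.exp (-(Do * r ^ 2 + Df * r ^ (2 * α)) * t) =
        2 * (Real.cos (y * r) * Real.exp (-(Do * r ^ 2 + Df * r ^ (2 * α)) * t)) := by
      intro r
      rw [sphereTransform_one]
      simp [mul_assoc]
    simp only [e] at h1 h2
    refine ⟨?_, ?_⟩
    · refine (h1.const_mul (1 / 2)).congr (.of_forall fun r => ?_)
      simp only
      ring
    · rw [h2, integral_const_mul]
      have h (I : ℝ) : 1 / (2 * Real.pi) * (2 * I) = 1 / Real.pi * I := by field_simp
      exact h _
  · have e : ∀ r : ℝ, (r / (2 * Real.pi)) ^ (d - 1) * sphereTransform d (y * r) *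
        Real.exp (-(Do * r ^ 2 + Df * r ^ (2 * α)) * t) =
        sphereArea (d - 1) * ((r / (2 * Real.pi)) ^ (d - 1) *
          Real.exp (-(Do * r ^ 2 + Df * r ^ (2 * α)) * t)) := by
      intro r
      rw [hy0, zero_mul, sphereTransform_zero_eq_sphereArea hd]
      ring
    have hS : sphereArea (d - 1) ≠ 0 := by
      have : (0 : ℝ) < ((d - 1 : ℕ) : ℝ) + 1 := by positivity
      exact (div_pos (by positivity) (Real.Gamma_pos_of_pos (by positivity))).ne'
    simp only [e] at h1 h2
    refine ⟨?_, ?_⟩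
    · refine (h1.const_mul (sphereArea (d - 1))⁻¹).congr (.of_forall fun r => ?_)
      simp only
      rw [inv_mul_cancel_left₀ hS]
    · rw [h2, integral_const_mul]
      ring
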